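/- **Theorem (worst-case error bound for digital nets).** Let $s,\alpha,m\ge 1$ be integers with $\alpha>1$, let $b$ be prime, let $1\le q,r,r'\le\infty$ with $1/r+1/r'=1$, and let $\gamma=(\gamma_u)_{u\subseteq\{1,\dots,s\}}$ be nonnegative real weights. *Function space.* For $F:[0,1]^s\to\mathbb R$ with (weak) mixed partial derivatives $\partial^\nu F\in L_1([0,1]^s)$ for all $\nu\in\{0,\dots,\alpha\}^s$, let $$\|F\|_{s,\alpha,\gamma,q,r}=\Bigg(\sum_{u\subseteq\{1,\dots,s\}}\Bigg(\gamma_u^{-q}\sum_{v\subseteq u}\ \sum_{\tau\in\{1,\dots,\alpha\}^{u\setminus v}}\int_{[0,1]^{v}}\bigg|\int_{[0,1]^{s-|v|}}\partial^{(\alpha_v,\tau_{u\setminus v},0)}F(y)\,dy_{\{1,\dots,s\}\setminus v}\bigg|^q dy_v\Bigg)^{r/q}\Bigg)^{1/r},$$ with the usual modifications for $q=\infty$ or $r=\infty$; here $(\alpha_v,\tau_{u\setminus v},0)$ has entries $\alpha$ on $v$, $\tau_j$ for $j\in u\setminus v$, and $0$ outside $u$. If $\gamma_u=0$, the term of $u$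 is $0$ when all its integrals vanish and $\infty$ otherwise. Let $\mathcal W_{s,\alpha,\gamma,q,r}$ be the space of all such $F$, represented by continuous functions on $[0,1]^s$, with finite norm. *Digital net.* Let $C_1,\dots,C_s\in\mathbb Z_b^{\alpha m\times m}$. For $0\le n<b^m$ with $n=\eta_0+\eta_1b+\dots+\eta_{m-1}b^{m-1}$, $\eta_i\in\{0,\dots,b-1\}$, put $(\zeta_1,\dots,\zeta_{\alpha m})^\top=C_j(\eta_0,\dots,\eta_{m-1})^\top$, let $y^{(n)}_j=\sum_{i=1}^{\alpha m}\zeta_i b^{-i}$ (with $\zeta_i$ read in $\{0,\dots,b-1\}$), and $y_n=(y^{(n)}_1,\dots,y^{(n)}_s)$. *Error criterion.* For $k=\varkappa_0+\varkappa_1b+\cdots$ with $\varkappa_i\in\{0,\dots,b-1\}$ let $\mathrm{tr}_{\alpha m}(k)=(\varkappa_0,\dots,\varkappa_{\alpha m-1})^\top$. For $\emptyset\ne u\subseteq\{1,\dots,s\}$ let $$D_u^*=\Big\{k\in\mathbb N^{u}:\ \textstyle\sum_{j\in u}C_j^\top\,\mathrm{tr}_{\alpha m}(k_j)=0\in\mathbb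 Z_b^m\Big\},\qquad \mathbb N=\{1,2,\dots\}.$$ For $k=\kappa_1b^{a_1-1}+\dots+\kappa_\rho b^{a_\rho-1}$ with $\kappa_i\in\{1,\dots,b-1\}$ and $a_1>\dots>a_\rho>0$ let $\mu_\alpha(k)=a_1+\dots+a_{\min(\alpha,\rho)}$, let $\mu_\alpha(0)=0$, and for $k\in\mathbb N^u$ let $\mu_\alpha(k)=\sum_{j\in u}\mu_\alpha(k_j)$. Let $$C_{\alpha,b}=\max\!\Big(\tfrac{2}{(2\sin\frac\pi b)^{\alpha}},\max_{1\le z\le\alpha-1}\tfrac1{(2\sin\frac\pi b)^z}\Big)\Big(1+\tfrac1b+\tfrac1{b(b+1)}\Big)^{\alpha-2}\Big(3+\tfrac2b+\tfrac{2b+1}{b-1}\Big),$$ $$e_{s,\alpha,\gamma,r'}=\Bigg(\sum_{\emptyset\ne u\subseteq\{1,\dots,s\}}\Big(C_{\alpha,b}^{|u|}\,\gamma_u\sum_{k\in D_u^*}b^{-\mu_\alpha(k)}\Big)^{r'}\Bigg)^{1/r'}$$ (a maximum over $u$ if $r'=\infty$). *Conclusion.* Then $e_{s,\alpha,\gamma,r'}<\infty$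 and $$\sup_{F\in\mathcal W_{s,\alpha,\gamma,q,r},\ \|F\|_{s,\alpha,\gamma,q,r}\le1}\bigg|\frac1{b^m}\sum_{n=0}^{b^m-1}F(y_n)-\int_{[0,1]^s}F(y)\,dy\bigg|\le e_{s,\alpha,\gamma,r'}.$$ Moreover, for every $\sigma\in[0,1)^s$ the same bound holds with $y_n$ replaced by the digitally shifted point $y_n\oplus\sigma$, where $\oplus$ is componentwise digit-wise addition modulo $b$ of base-$b$ expansions (those with infinitely many digits different from $b-1$). -/

import Mathlib

open scoped ENNReal NNReal ContDiff Matrix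
open MeasureTheory

noncomputable section

namespace QMC

/-- The closed unit cube `[0,1]^s`. -/
def cube (s : ℕ) : Set (Fin s → ℝ) := Set.Icc 0 1

/-- The `ℓ_p` combination `(∑_{i ∈ S} a_i ^ p) ^ (1/p)` of nonnegative extended reals,
read as `max_{i ∈ S} a_i` for `p = ∞`. -/
def lpSum {ι : Type*} (p : ℝ≥0∞) (S : Finset ι) (a : ι → ℝ≥0∞) : ℝ≥0∞ :=
  if p = ⊤ then S.sup a else (∑ i ∈ S, a i ^ p.toReal) ^ (1 / p.toReal)

/-! ### The weighted unanchored Sobolev space -/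

/-- `g` is the weak partial derivative of `f` in the `j`-th coordinate on the open unit cube
(tested against smooth functions with compact support in the open cube). -/
def IsWeakPartial {s : ℕ} (j : Fin s) (f g : (Fin s → ℝ) → ℝ) : Prop :=
  ∀ φ : (Fin s → ℝ) → ℝ, ContDiff ℝ ∞ φ → HasCompactSupport φ →
    (tsupport φ ⊆ Set.univ.pi fun _ => Set.Ioo (0 : ℝ) 1) →
    ∫ x in cube s, f x * fderiv ℝ φ x (Pi.single j 1) = - ∫ x in cube s, g x * φ x

/-- `D ν`, for the multi-indices `ν ∈ {0,…,α}^s`, are the mixed partial derivatives `∂^ν F` on the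
unit cube: all of them are integrable and each is obtained from the ones of lower order by
weak differentiation, starting from `D 0 = F`. -/
structure IsMixedDerivFamily {s : ℕ} (α : ℕ) (F : (Fin s → ℝ) → ℝ)
    (D : (Fin s → ℕ) → (Fin s → ℝ) → ℝ) : Prop where
  zero : D 0 = F
  integrable : ∀ ν : Fin s → ℕ, (∀ j, ν j ≤ α) → IntegrableOn (D ν) (cube s)
  weakPartial : ∀ ν : Fin s → ℕ, (∀ j, ν j ≤ α) → ∀ j, ν j < α →
    IsWeakPartial j (D ν) (D (ν + Pi.single j 1))

/-- The function `y ↦ ∫ g(y) dy_{-v}`, obtained by integrating out the coordinates outside `v`.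
It depends on the coordinates `y_j`, `j ∈ v`, only (the coordinates `z_j`, `j ∈ v`, of the
integration variable do not enter, and run over a set of measure one). -/
def integrateOut {s : ℕ} (v : Finset (Fin s)) (g : (Fin s → ℝ) → ℝ) (y : Fin s → ℝ) : ℝ :=
  ∫ z in cube s, g (v.piecewise y z)

/-- The pairs `(v, τ)` with `v ⊆ u` and `τ ∈ {1,…,α}^{u \ v}`, where `τ` is extended by `0`
outside `u \ v`. -/
def derivIndices {s : ℕ} (α : ℕ) (u : Finset (Fin s)) :
    Finset (Σ _ : Finset (Fin s), Fin s → ℕ) :=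
  u.powerset.sigma fun v =>
    Fintype.piFinset fun j => if j ∈ u \ v then Finset.Icc 1 α else {0}

/-- The multi-index `(α_v, τ_{u \ v}, 0)`. -/
def multiIndex {s : ℕ} (α : ℕ) (v : Finset (Fin s)) (τ : Fin s → ℕ) : Fin s → ℕ :=
  fun j => if j ∈ v then α else τ j

/-- The value of the norm, computed from the mixed derivatives `D ν = ∂^ν F`:
the `ℓ_r` combination over `u ⊆ {1,…,s}` of `γ_u⁻¹` times the `ℓ_q` combination over the pairs
`(v, τ)` of the `L_q([0,1]^v)` norms of `∫ ∂^{(α_v, τ_{u \ v}, 0)} F(y) dy_{-v}`.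
As the inner function does not depend on the coordinates outside `v`, its `L_q` norm is taken
over `[0,1]^s`. In `ℝ≥0∞` a weight `γ_u = 0` means that the corresponding
term is `0` if all its derivative integrals vanish, and `∞` otherwise. -/
def familyNorm {s : ℕ} (α : ℕ) (γ : Finset (Fin s) → ℝ≥0) (q r : ℝ≥0∞)
    (D : (Fin s → ℕ) → (Fin s → ℝ) → ℝ) : ℝ≥0∞ :=
  lpSum r Finset.univ fun u : Finset (Fin s) =>
    (γ u : ℝ≥0∞)⁻¹ * lpSum q (derivIndices α u) fun p =>
      eLpNorm (integrateOut p.1 (D (multiIndex α p.1 p.2))) q (volume.restrict (cube s))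

/-- The norm `‖F‖_{s,α,γ,q,r}`. Weak derivatives are unique almost everywhere, so all families
of mixed derivatives of `F` give the same value, and the infimum only serves to select it;
the norm is `∞` if `F` does not have all its mixed derivatives. -/
def sobolevNorm {s : ℕ} (α : ℕ) (γ : Finset (Fin s) → ℝ≥0) (q r : ℝ≥0∞)
    (F : (Fin s → ℝ) → ℝ) : ℝ≥0∞ :=
  ⨅ (D : (Fin s → ℕ) → (Fin s → ℝ) → ℝ) (_ : IsMixedDerivFamily α F D), familyNorm α γ q r D

/-- The space `W_{s,α,γ,q,r}` of functions on the unit cube (values outside the cube are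
irrelevant): each function is represented by its continuous version, so that point values
are meaningful. -/
def sobolevSpace {s : ℕ} (α : ℕ) (γ : Finset (Fin s) → ℝ≥0) (q r : ℝ≥0∞) :
    Set ((Fin s → ℝ) → ℝ) :=
  {F | ContinuousOn F (cube s) ∧ sobolevNorm α γ q r F < ⊤}

/-- The error of the equal-weight quadrature rule with the points `y 0, …, y (N-1)`. -/
def quadratureError {s : ℕ} (N : ℕ) (y : ℕ → Fin s → ℝ) (F : (Fin s → ℝ) → ℝ) : ℝ :=
  |1 / (N : ℝ) * ∑ n ∈ Finset.range N, F (y n) - ∫ x in cube s, F x|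

/-- The worst-case error over the unit ball of `W_{s,α,γ,q,r}`. -/
def worstCaseError {s : ℕ} (α : ℕ) (γ : Finset (Fin s) → ℝ≥0) (q r : ℝ≥0∞)
    (N : ℕ) (y : ℕ → Fin s → ℝ) : ℝ≥0∞ :=
  ⨆ F ∈ {F ∈ sobolevSpace α γ q r | sobolevNorm α γ q r F ≤ 1},
    ENNReal.ofReal (quadratureError N y F)

/-! ### Digital nets and digital shifts -/

/-- The digit `ϰ_i` of `k = ϰ_0 + ϰ_1 b + ϰ_2 b² + ⋯`. -/
def natDigit (b k i : ℕ) : ℕ := k / b ^ i % b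

/-- The first `l` base-`b` digits of `k`, as a vector over `ℤ_b`. -/
def digitVec (b l k : ℕ) : Fin l → ZMod b := fun i => (natDigit b k i : ZMod b)

/-- The `n`-th point of the digital net with generating matrices `C_1, …, C_s`. -/
def digitalNet {s : ℕ} (b α m : ℕ) (C : Fin s → Matrix (Fin (α * m)) (Fin m) (ZMod b))
    (n : ℕ) : Fin s → ℝ :=
  fun j => ∑ i : Fin (α * m),
    (((C j *ᵥ digitVec b m n) i).val : ℝ) / (b : ℝ) ^ ((i : ℕ) + 1)

/-- The digital shift `y ⊕ σ` of points of `[0,1)^s`: digit-wise addition modulo `b` of the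
base-`b` expansions with infinitely many digits different from `b - 1`
(addition in `Fin b` is modulo `b`). -/
def digitalShift {s : ℕ} (b : ℕ) [NeZero b] (y σ : Fin s → ℝ) : Fin s → ℝ :=
  fun j => Real.ofDigits fun i => Real.digits (y j) b i + Real.digits (σ j) b i

/-! ### The error criterion -/

/-- The positions `a ≥ 1` of the nonzero digits of `k`, i.e. the exponents in
`k = κ_1 b^{a_1 - 1} + ⋯ + κ_ρ b^{a_ρ - 1}` with `κ_i ∈ {1,…,b-1}`
(for `b ≥ 2` they are at most `k`). -/
def digitPositions (b k : ℕ) : Finset ℕ :=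
  (Finset.Icc 1 k).filter fun a => natDigit b k (a - 1) ≠ 0

/-- `μ_α(k) = a_1 + ⋯ + a_{min(α,ρ)}`, where `a_1 > ⋯ > a_ρ` are the positions of the nonzero
digits of `k`; `μ_α(0) = 0`. -/
def mu (α b k : ℕ) : ℕ := (((digitPositions b k).sort (· ≥ ·)).take α).sum

/-- The constant `C_{α,b}`. -/
def walshConst (α b : ℕ) : ℝ :=
  (Finset.Icc 1 (α - 1)).fold max (2 / (2 * Real.sin (Real.pi / b)) ^ α)
      (fun z => 1 / (2 * Real.sin (Real.pi / b)) ^ z)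
    * (1 + 1 / (b : ℝ) + 1 / ((b : ℝ) * ((b : ℝ) + 1))) ^ (α - 2)
    * (3 + 2 / (b : ℝ) + (2 * (b : ℝ) + 1) / ((b : ℝ) - 1))

/-- The dual net without zero components, projected to the components in `u`. -/
def dualNet {s : ℕ} (b α m : ℕ) (C : Fin s → Matrix (Fin (α * m)) (Fin m) (ZMod b))
    (u : Finset (Fin s)) : Set (u → ℕ) :=
  {k | (∀ j, 1 ≤ k j) ∧ ∑ j : u, (C j)ᵀ *ᵥ digitVec b (α * m) (k j) = 0}

/-- The error criterion `e_{s,α,γ,r'}` of the digital net with generating matrices `C`. -/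
def errorCriterion {s : ℕ} (b α m : ℕ) (γ : Finset (Fin s) → ℝ≥0) (r' : ℝ≥0∞)
    (C : Fin s → Matrix (Fin (α * m)) (Fin m) (ZMod b)) : ℝ≥0∞ :=
  lpSum r' (Finset.univ.filter fun u : Finset (Fin s) => u.Nonempty) fun u =>
    ENNReal.ofReal (walshConst α b) ^ u.card * (γ u : ℝ≥0∞) *
      ∑' k : dualNet b α m C u, ((b : ℝ≥0∞)⁻¹) ^ (∑ j : u, mu α b ((k : u → ℕ) j))

end QMC

end

/-!
The partial sums of the Walsh series of `F` over the boxes `[0, b^l)^s` are the averages of `F` over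
the elementary intervals around a point, so they converge to `F` at every point of `[0,1)^s`. On the
points of a digital net the `k`-th Walsh function averages to `0` unless `k` belongs to the dual
net, and a digital shift only multiplies it by a number of modulus one. The quadrature error is
therefore at most the sum of the absolute Walsh coefficients over the nonzero part of the dual net.

To bound a coefficient whose index has support `u`, integrate by parts in one coordinate of `u` at a
time, against the iterated primitives of the one-dimensional Walsh function. Normalising each
primitive to be periodic splits off its mean: the mean stops the integration in that coordinate
after `τ_j` steps, while the rest goes on until the order `α` is reached, which is exactly how the
derivatives `(α_v, τ_{u \ v}, 0)` of the unanchored norm arise. In each of the first `α`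
integrations the leading digit of the Walsh function at position `a` makes its primitive oscillate
at the scale `b^{-a}` and gains that factor, hence the decay `b^{-μ_α(k)}`. Hölder's inequality for
the sum over `u` concludes.
-/

open ZMod (stdAddChar)

noncomputable section

namespace QMC

/-! ### Primitives of bounded measurable functions -/

/-- Bounded measurable functions on the line: the class in which all one-dimensional factors
(Walsh functions, their iterated primitives, Walsh kernels) live. -/
structure BddMeasurable (f : ℝ → ℂ) : Prop where
  measurable : Measurable f
  exists_bound : ∃ C : ℝ, ∀ x, ‖f x‖ ≤ C

/-- The primitive of `f` vanishing at `0`; thus `prim f 1` is the mean of `f` over `[0,1]`. -/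
def prim (f : ℝ → ℂ) (x : ℝ) : ℂ := ∫ t in (0 : ℝ)..x, f t

section Prim
variable {f g : ℝ → ℂ} {ℓ N : ℝ}

lemma bddMeasurable_const (c : ℂ) : BddMeasurable fun _ => c :=
  ⟨measurable_const, ‖c‖, fun _ => le_rfl⟩

lemma BddMeasurable.mul (hf : BddMeasurable f) (hg : BddMeasurable g) :
    BddMeasurable fun x => f x * g x := by
  obtain ⟨C, hC⟩ := hf.exists_bound
  obtain ⟨D, hD⟩ := hg.exists_bound
  refine ⟨hf.measurable.mul hg.measurable, C * D, fun x => ?_⟩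
  rw [norm_mul]
  exact mul_le_mul (hC x) (hD x) (norm_nonneg _) ((norm_nonneg _).trans (hC x))

lemma BddMeasurable.sub_const (hf : BddMeasurable f) (c : ℂ) :
    BddMeasurable fun x => f x - c := by
  obtain ⟨C, hC⟩ := hf.exists_bound
  exact ⟨hf.measurable.sub_const c, C + ‖c‖,
    fun x => (norm_sub_le _ _).trans (by gcongr; exact hC x)⟩

lemma BddMeasurable.intervalIntegrable (hf : BddMeasurable f) (x y : ℝ) :
    IntervalIntegrable f volume x y := by
  obtain ⟨C, hC⟩ := hf.exists_bound
  refine (intervalIntegrable_const (c := C)).mono_fun hf.measurable.aestronglyMeasurable ?_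
  filter_upwards with t
  exact (hC t).trans (le_abs_self C)

@[simp] lemma prim_zero (f : ℝ → ℂ) : prim f 0 = 0 := by simp [prim]

@[simp] lemma prim_const (c : ℂ) (x : ℝ) : prim (fun _ => c) x = c * x := by
  simp [prim, mul_comm]

lemma BddMeasurable.prim_sub_const (hf : BddMeasurable f) (c : ℂ) (x : ℝ) :
    prim (fun t => f t - c) x = prim f x - c * x := by
  rw [← prim_const, prim,
    intervalIntegral.integral_sub (hf.intervalIntegrable _ _) intervalIntegrable_const]
  rfl

lemma BddMeasurable.prim_add_integral (hf : BddMeasurable f) (x y : ℝ) :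
    prim f x + ∫ t in x..y, f t = prim f y :=
  intervalIntegral.integral_add_adjacent_intervals (hf.intervalIntegrable _ _)
    (hf.intervalIntegrable _ _)

lemma BddMeasurable.continuous_prim (hf : BddMeasurable f) : Continuous (prim f) :=
  intervalIntegral.continuous_primitive (fun _ _ => hf.intervalIntegrable _ _) 0

lemma BddMeasurable.norm_prim_sub_prim_le (hf : BddMeasurable f) (hN : ∀ x, ‖f x‖ ≤ N)
    (x y : ℝ) : ‖prim f y - prim f x‖ ≤ N * |y - x| := by
  rw [← hf.prim_add_integral x y, add_sub_cancel_left]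
  exact intervalIntegral.norm_integral_le_of_norm_le_const fun t _ => hN t

lemma BddMeasurable.periodic_prim (hf : BddMeasurable f) (hp : Function.Periodic f ℓ)
    (h0 : prim f ℓ = 0) : Function.Periodic (prim f) ℓ := by
  intro x
  have h := hp.intervalIntegral_add_eq x 0
  rw [zero_add] at h
  rw [← hf.prim_add_integral x, h, ← prim, h0, add_zero]

/-- Going from `x` to a translate of `y` in the shorter direction takes at most half a period. -/
lemma BddMeasurable.norm_prim_sub_prim_le_of_periodic (hf : BddMeasurable f) (hℓ : 0 < ℓ)
    (hp : Function.Periodic f ℓ) (h0 : prim f ℓ = 0) (hN : ∀ x, ‖f x‖ ≤ N) (x y : ℝ) :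
    ‖prim f y - prim f x‖ ≤ ℓ * N / 2 := by
  have hN0 : 0 ≤ N := (norm_nonneg _).trans (hN 0)
  have hP := hf.periodic_prim hp h0
  obtain ⟨y', hy', hyy⟩ := hP.exists_mem_Ico hℓ y x
  rw [hyy]
  rcases le_total (y' - x) (ℓ / 2) with h | h
  · refine (hf.norm_prim_sub_prim_le hN x y').trans ?_
    rw [abs_of_nonneg (by linarith [hy'.1])]
    nlinarith
  · rw [← hP x]
    refine (hf.norm_prim_sub_prim_le hN (x + ℓ) y').trans ?_
    rw [abs_of_nonpos (by linarith [hy'.2])]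
    nlinarith

lemma BddMeasurable.norm_prim_le_of_periodic (hf : BddMeasurable f) (hℓ : 0 < ℓ)
    (hp : Function.Periodic f ℓ) (h0 : prim f ℓ = 0) (hN : ∀ x, ‖f x‖ ≤ N) (x : ℝ) :
    ‖prim f x‖ ≤ ℓ * N / 2 := by
  simpa using hf.norm_prim_sub_prim_le_of_periodic hℓ hp h0 hN 0 x

lemma BddMeasurable.prim_of_periodic (hf : BddMeasurable f) (hℓ : 0 < ℓ)
    (hp : Function.Periodic f ℓ) (h0 : prim f ℓ = 0) : BddMeasurable (prim f) := by
  obtain ⟨N, hN⟩ := hf.exists_bound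
  exact ⟨hf.continuous_prim.measurable, ℓ * N / 2, hf.norm_prim_le_of_periodic hℓ hp h0 hN⟩

end Prim

section StepFunction
variable {M : ℝ} {s S : ℤ → ℂ} {p : ℝ → ℂ}

lemma bddMeasurable_step (hs : ∃ C : ℝ, ∀ n, ‖s n‖ ≤ C) (M : ℝ) :
    BddMeasurable fun t => s ⌊t * M⌋ := by
  obtain ⟨C, hC⟩ := hs
  exact ⟨(measurable_from_top (f := s)).comp
    (Int.measurable_floor.comp (measurable_id.mul_const M)), C, fun _ => hC _⟩

lemma integral_step_mul_of_mem_cell (hM : 0 < M) (s : ℤ → ℂ) (hp : Function.Periodic p M⁻¹)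
    {n : ℤ} {x : ℝ} (hx : x ∈ Set.Icc (n * M⁻¹) ((n + 1) * M⁻¹)) :
    ∫ t in (n * M⁻¹)..x, s ⌊t * M⌋ * p t = s n * prim p (x - n * M⁻¹) := by
  have hfloor : ∀ᵐ t : ℝ, t ∈ Set.uIoc (n * M⁻¹) x → s ⌊t * M⌋ * p t = s n * p t := by
    have hne : ∀ᵐ t : ℝ, t ≠ (n + 1) * M⁻¹ := by simp [ae_iff, measure_singleton]
    filter_upwards [hne] with t ht hmem
    rw [Set.uIoc_of_le hx.1] at hmem
    have hlt : t < (n + 1) * M⁻¹ := lt_of_le_of_ne (hmem.2.trans hx.2) ht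
    have : ⌊t * M⌋ = n := by
      rw [Int.floor_eq_iff, ← div_le_iff₀ hM, ← lt_div_iff₀ hM]
      exact ⟨hmem.1.le, hlt⟩
    rw [this]
  have htranslate : ∫ t in (n * M⁻¹)..x, p t = prim p (x - n * M⁻¹) := by
    have h := intervalIntegral.integral_comp_add_right (a := 0) (b := x - n * M⁻¹) p (n * M⁻¹)
    rw [zero_add, sub_add_cancel] at h
    rw [← h]
    exact intervalIntegral.integral_congr fun t _ => hp.int_mul n t
  rw [intervalIntegral.integral_congr_ae hfloor, intervalIntegral.integral_const_mul, htranslate]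

variable (hM : 0 < M) (hs : ∃ C : ℝ, ∀ n, ‖s n‖ ≤ C) (hp : Function.Periodic p M⁻¹)
  (hpm : BddMeasurable p) (hS : ∀ n, S (n + 1) = S n + s n * prim p M⁻¹)
include hM hs hp hpm

include hS in
lemma prim_step_mul_intCast (n : ℤ) :
    prim (fun t => s ⌊t * M⌋ * p t) (n * M⁻¹) = S n - S 0 := by
  have hcell (n : ℤ) : prim (fun t => s ⌊t * M⌋ * p t) ((n + 1 : ℤ) * M⁻¹)
      = prim (fun t => s ⌊t * M⌋ * p t) (n * M⁻¹) + (S (n + 1) - S n) := by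
    have hMinv : 0 < M⁻¹ := inv_pos.mpr hM
    rw [← ((bddMeasurable_step hs M).mul hpm).prim_add_integral (n * M⁻¹),
      integral_step_mul_of_mem_cell hM s hp ⟨by push_cast; nlinarith, by push_cast; rfl⟩, hS]
    rw [show ((n + 1 : ℤ) : ℝ) * M⁻¹ - n * M⁻¹ = M⁻¹ by push_cast; ring, add_sub_cancel_left]
  induction n using Int.induction_on with
  | zero => simp
  | succ i ih => rw [hcell, ih]; ring
  | pred i ih =>
    have h := hcell (-(i : ℤ) - 1)
    rw [sub_add_cancel, ih] at h
    linear_combination -h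

include hS in
lemma prim_step_mul (x : ℝ) :
    prim (fun t => s ⌊t * M⌋ * p t) x
      = S ⌊x * M⌋ - S 0 + s ⌊x * M⌋ * prim p (x - ⌊x * M⌋ * M⁻¹) := by
  rw [← ((bddMeasurable_step hs M).mul hpm).prim_add_integral (⌊x * M⌋ * M⁻¹),
    prim_step_mul_intCast hM hs hp hpm hS, integral_step_mul_of_mem_cell hM s hp]
  constructor
  · rw [← div_eq_mul_inv, div_le_iff₀ hM]
    exact Int.floor_le _
  · rw [← div_eq_mul_inv, le_div_iff₀ hM]
    exact (Int.lt_floor_add_one _).le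

lemma prim_step_mul_of_prim_eq_zero (h0 : prim p M⁻¹ = 0) (x : ℝ) :
    prim (fun t => s ⌊t * M⌋ * p t) x = s ⌊x * M⌋ * prim p x := by
  rw [prim_step_mul hM hs hp hpm (S := 0) (by simp [h0]),
    ((hpm.periodic_prim hp h0).int_mul ⌊x * M⌋).sub_eq x]
  simp

end StepFunction

/-! ### Twisting by a character of the leading digit -/

/-- `f` has period `ℓ`, mean `m` over a period, and distance at most `N` from its mean. This is the
data that integration against Walsh functions propagates. -/
structure HasMeanOsc (f : ℝ → ℂ) (ℓ : ℝ) (m : ℂ) (N : ℝ) : Prop where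
  bddMeasurable : BddMeasurable f
  periodic : Function.Periodic f ℓ
  prim_period : prim f ℓ = m * ℓ
  norm_sub_le : ∀ x, ‖f x - m‖ ≤ N

section HasMeanOsc
variable {f : ℝ → ℂ} {ℓ : ℝ} {m : ℂ} {N : ℝ}

lemma hasMeanOsc_const (c : ℂ) (ℓ : ℝ) : HasMeanOsc (fun _ => c) ℓ c 0 :=
  ⟨bddMeasurable_const c, fun _ => rfl, prim_const c ℓ, by simp⟩

lemma HasMeanOsc.nonneg (hf : HasMeanOsc f ℓ m N) : 0 ≤ N :=
  (norm_nonneg _).trans (hf.norm_sub_le 0)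

lemma HasMeanOsc.sub_mean (hf : HasMeanOsc f ℓ m N) : HasMeanOsc (fun x => f x - m) ℓ 0 N where
  bddMeasurable := hf.bddMeasurable.sub_const m
  periodic x := by simp only [hf.periodic x]
  prim_period := by rw [hf.bddMeasurable.prim_sub_const, hf.prim_period, sub_self, zero_mul]
  norm_sub_le x := by simpa using hf.norm_sub_le x

lemma HasMeanOsc.norm_prim_sub_mul_le (hℓ : 0 < ℓ) (hf : HasMeanOsc f ℓ m N) (x : ℝ) :
    ‖prim f x - m * x‖ ≤ ℓ * N / 2 := by
  have hf' := hf.sub_mean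
  rw [← hf.bddMeasurable.prim_sub_const]
  refine hf'.bddMeasurable.norm_prim_le_of_periodic hℓ hf'.periodic ?_
    (by simpa using hf'.norm_sub_le) x
  rw [hf'.prim_period, zero_mul]

lemma norm_average_sub_le {g : ℝ → ℂ} {C : ℝ} (hg : BddMeasurable g) (z : ℂ)
    (h : ∀ t, ‖g t - z‖ ≤ C) : ‖prim g 1 - z‖ ≤ C := by
  have : prim g 1 - z = prim (fun t => g t - z) 1 := by simp [hg.prim_sub_const]
  rw [this]
  exact (intervalIntegral.norm_integral_le_of_norm_le_const fun t _ => h t).trans (by simp)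

lemma HasMeanOsc.prim_of_mean_zero (hf : HasMeanOsc f 1 0 N) :
    ‖prim (prim f) 1‖ ≤ N / 2 ∧ HasMeanOsc (prim f) 1 (prim (prim f) 1) (N / 2) := by
  have h0 : prim f 1 = 0 := by simpa using hf.prim_period
  have hN : ∀ x, ‖f x‖ ≤ N := by simpa using hf.norm_sub_le
  have hP := hf.bddMeasurable.prim_of_periodic one_pos hf.periodic h0
  have hosc : ∀ x y, ‖prim f y - prim f x‖ ≤ N / 2 := by
    simpa using hf.bddMeasurable.norm_prim_sub_prim_le_of_periodic one_pos hf.periodic h0 hN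
  refine ⟨by simpa using norm_average_sub_le hP 0 (C := N / 2) (by simpa using hosc 0), hP,
    hf.bddMeasurable.periodic_prim hf.periodic h0, by simp, fun x => ?_⟩
  rw [norm_sub_rev]
  exact norm_average_sub_le hP _ (hosc x)

end HasMeanOsc

/-- The constant `1 / (2 sin (π / b))`, the largest value of `1 / |ω - 1|` over the `b`-th roots of
unity `ω ≠ 1`. -/
def sinConst (b : ℕ) : ℝ := 1 / (2 * Real.sin (Real.pi / b))

lemma sin_pi_div_pos {b : ℕ} (hb : 2 ≤ b) : 0 < Real.sin (Real.pi / b) := by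
  have hb' : (2 : ℝ) ≤ b := by exact_mod_cast hb
  apply Real.sin_pos_of_pos_of_lt_pi
  · have := Real.pi_pos
    positivity
  · rw [div_lt_iff₀ (by positivity)]
    nlinarith [Real.pi_pos]

lemma sinConst_pos {b : ℕ} (hb : 2 ≤ b) : 0 < sinConst b := by
  have := sin_pi_div_pos hb
  unfold sinConst
  positivity

lemma sin_pi_div_le_sin_mul_div {b k : ℕ} (hk : 1 ≤ k) (hkb : k < b) :
    Real.sin (Real.pi / b) ≤ Real.sin (Real.pi * k / b) := by
  have hb : (0 : ℝ) < b := by exact_mod_cast (by omega : 0 < b)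
  have hπ := Real.pi_pos
  have hk' : (1 : ℝ) ≤ k := by exact_mod_cast hk
  have hkb' : (k : ℝ) + 1 ≤ b := by exact_mod_cast hkb
  have hlow : -(Real.pi / 2) ≤ Real.pi / b := by
    have : 0 < Real.pi / b := by positivity
    linarith
  rcases le_total (2 * (k : ℝ)) b with h | h
  · refine Real.sin_le_sin_of_le_of_le_pi_div_two hlow ?_ (by gcongr; nlinarith)
    rw [div_le_div_iff₀ hb two_pos]
    nlinarith
  · rw [← Real.sin_pi_sub (Real.pi * k / b),
      show Real.pi - Real.pi * k / b = Real.pi * (b - k) / b by field_simp]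
    refine Real.sin_le_sin_of_le_of_le_pi_div_two hlow ?_ (by gcongr; nlinarith)
    rw [div_le_div_iff₀ hb two_pos]
    nlinarith

lemma norm_one_add_sub_one_mul_le {z : ℂ} (hz : ‖z‖ ≤ 1) {t : ℝ} (ht : t ∈ Set.Icc (0 : ℝ) 1) :
    ‖1 + (z - 1) * t‖ ≤ 1 := by
  have hconv : 1 + (z - 1) * t = (1 - t) • 1 + t • z := by
    rw [Complex.real_smul, Complex.real_smul]
    push_cast
    ring
  rw [hconv, ← mem_closedBall_zero_iff]
  exact convex_closedBall (0 : ℂ) 1 (by simp) (by simpa using hz) (sub_nonneg.mpr ht.2) ht.1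
    (sub_add_cancel 1 t)

section Character
variable {b : ℕ} [NeZero b]

lemma stdAddChar_sub_one_ne_zero {x : ZMod b} (hx : x ≠ 0) : stdAddChar x - 1 ≠ 0 := by
  rw [sub_ne_zero, ← AddChar.map_zero_eq_one (stdAddChar (N := b))]
  exact ZMod.injective_stdAddChar.ne hx

lemma stdAddChar_mul_intCast_add_one (κ : ZMod b) (n : ℤ) :
    stdAddChar (κ * ((n + 1 : ℤ) : ZMod b)) = stdAddChar (κ * (n : ZMod b)) * stdAddChar κ := by
  rw [← AddChar.map_add_eq_mul]
  push_cast
  rw [mul_add, mul_one]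

lemma norm_inv_stdAddChar_sub_one_le (hb : 2 ≤ b) {x : ZMod b} (hx : x ≠ 0) :
    ‖(stdAddChar x - 1)⁻¹‖ ≤ sinConst b := by
  have hval : 1 ≤ x.val := Nat.one_le_iff_ne_zero.mpr ((ZMod.val_ne_zero x).mpr hx)
  have hexp : stdAddChar x = Complex.exp (Complex.I * ((2 * (Real.pi * x.val / b) : ℝ) : ℂ)) := by
    conv_lhs => rw [← ZMod.natCast_zmod_val x, ← Int.cast_natCast, ZMod.stdAddChar_coe]
    congr 1
    push_cast
    ring
  have hsin := sin_pi_div_le_sin_mul_div hval (ZMod.val_lt x)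
  have hpos := sin_pi_div_pos hb
  rw [norm_inv, hexp, Complex.norm_exp_I_mul_ofReal_sub_one, mul_div_cancel_left₀ _ two_ne_zero,
    sinConst, one_div]
  apply inv_anti₀ (by positivity)
  rw [Real.norm_eq_abs]
  exact (mul_le_mul_of_nonneg_left hsin zero_le_two).trans (le_abs_self _)

end Character

/-- `Φ` multiplied by the step function `t ↦ χ(κ ⌊M t⌋)`, where `χ` is the standard additive
character of `ℤ_b`. For `M = b ^ (a + 1)` this is the contribution of the digit `κ` at position
`a + 1` to a Walsh function. -/
def twist {b : ℕ} [NeZero b] (κ : ZMod b) (M : ℝ) (Φ : ℝ → ℂ) (t : ℝ) : ℂ :=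
  stdAddChar (κ * ((⌊t * M⌋ : ℤ) : ZMod b)) * Φ t

/-- The factor `r` such that the primitive of the twist of `Φ` is the twist of `r` minus a
constant. -/
def twistRemainder {b : ℕ} [NeZero b] (κ : ZMod b) (M : ℝ) (Φ : ℝ → ℂ) (t : ℝ) : ℂ :=
  prim Φ M⁻¹ * (stdAddChar κ - 1)⁻¹ + prim Φ (Int.fract (t * M) * M⁻¹)

section Twist
variable {b : ℕ} [NeZero b] {κ : ZMod b} {M : ℝ} {Φ : ℝ → ℂ} {m : ℂ} {N : ℝ}

lemma exists_bound_stdAddChar (κ : ZMod b) :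
    ∃ C : ℝ, ∀ n : ℤ, ‖stdAddChar (κ * (n : ZMod b))‖ ≤ C :=
  ⟨1, fun _ => (AddChar.norm_apply _ _).le⟩

lemma norm_twist (κ : ZMod b) (M : ℝ) (Φ : ℝ → ℂ) (t : ℝ) : ‖twist κ M Φ t‖ = ‖Φ t‖ := by
  rw [twist, norm_mul, AddChar.norm_apply, one_mul]

lemma BddMeasurable.twist (hΦ : BddMeasurable Φ) (κ : ZMod b) (M : ℝ) :
    BddMeasurable (twist κ M Φ) :=
  (bddMeasurable_step (exists_bound_stdAddChar κ) M).mul hΦ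

lemma periodic_twist (hM : 0 < M) (hp : Function.Periodic Φ M⁻¹) (κ : ZMod b) :
    Function.Periodic (twist κ M Φ) (b * M⁻¹) := by
  intro x
  have hfloor : ⌊(x + b * M⁻¹) * M⌋ = ⌊x * M⌋ + b := by
    rw [add_mul, mul_assoc, inv_mul_cancel₀ hM.ne', mul_one, Int.floor_add_natCast]
  simp [twist, hfloor, hp.nat_mul b x]

lemma prim_twist (hκ : κ ≠ 0) (hM : 0 < M) (hp : Function.Periodic Φ M⁻¹)
    (hΦ : BddMeasurable Φ) (x : ℝ) :
    prim (twist κ M Φ) x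
      = twist κ M (twistRemainder κ M Φ) x - prim Φ M⁻¹ * (stdAddChar κ - 1)⁻¹ := by
  have hχ := stdAddChar_sub_one_ne_zero hκ
  have hS (n : ℤ) : prim Φ M⁻¹ * (stdAddChar κ - 1)⁻¹ * stdAddChar (κ * ((n + 1 : ℤ) : ZMod b))
      = prim Φ M⁻¹ * (stdAddChar κ - 1)⁻¹ * stdAddChar (κ * (n : ZMod b))
        + stdAddChar (κ * (n : ZMod b)) * prim Φ M⁻¹ := by
    rw [stdAddChar_mul_intCast_add_one]
    field_simp
    ring
  have hfract : x - ⌊x * M⌋ * M⁻¹ = Int.fract (x * M) * M⁻¹ := by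
    rw [Int.fract, sub_mul, mul_inv_cancel_right₀ hM.ne']
  unfold twist twistRemainder
  rw [prim_step_mul hM (exists_bound_stdAddChar κ) hp hΦ (S := fun n =>
    prim Φ M⁻¹ * (stdAddChar κ - 1)⁻¹ * stdAddChar (κ * (n : ZMod b))) hS x, hfract]
  simp only [Int.cast_zero, mul_zero, AddChar.map_zero_eq_one]
  ring

/-- The twisting character sums to zero over the `b` cells of a period. -/
lemma prim_twist_period (hκ : κ ≠ 0) (hM : 0 < M) (hp : Function.Periodic Φ M⁻¹)
    (hΦ : BddMeasurable Φ) : prim (twist κ M Φ) (b * M⁻¹) = 0 := by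
  rw [prim_twist hκ hM hp hΦ, twist, twistRemainder, mul_assoc, inv_mul_cancel₀ hM.ne', mul_one]
  simp

lemma periodic_twistRemainder (hM : 0 < M) (κ : ZMod b) (Φ : ℝ → ℂ) :
    Function.Periodic (twistRemainder κ M Φ) M⁻¹ := fun x => by
  simp only [twistRemainder, add_mul, inv_mul_cancel₀ hM.ne', Int.fract_add_one]

lemma HasMeanOsc.norm_prim_mul_inv_le (hb : 2 ≤ b) (hκ : κ ≠ 0) (hM : 0 < M)
    (hΦ : HasMeanOsc Φ M⁻¹ m N) :
    ‖prim Φ M⁻¹ * (stdAddChar κ - 1)⁻¹‖ ≤ M⁻¹ * (sinConst b * ‖m‖) := by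
  have hMinv : 0 ≤ M⁻¹ := (inv_pos.mpr hM).le
  rw [hΦ.prim_period, norm_mul, norm_mul, Complex.norm_real, Real.norm_of_nonneg hMinv]
  nlinarith [norm_inv_stdAddChar_sub_one_le hb hκ, mul_nonneg (norm_nonneg m) hMinv]

/-- Inside a cell the mean of `Φ` contributes a convex combination of two values of modulus
`‖prim Φ M⁻¹ * (χ κ - 1)⁻¹‖`. -/
lemma HasMeanOsc.norm_twistRemainder_le (hb : 2 ≤ b) (hκ : κ ≠ 0) (hM : 0 < M)
    (hΦ : HasMeanOsc Φ M⁻¹ m N) (x : ℝ) :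
    ‖twistRemainder κ M Φ x‖ ≤ M⁻¹ * (sinConst b * ‖m‖ + N / 2) := by
  have hMinv : 0 < M⁻¹ := inv_pos.mpr hM
  have hχ := stdAddChar_sub_one_ne_zero hκ
  set y := Int.fract (x * M)
  set A := prim Φ M⁻¹ * (stdAddChar κ - 1)⁻¹ with hA
  have hsplit : twistRemainder κ M Φ x = A * (1 + (stdAddChar κ - 1) * y)
      + (prim Φ (y * M⁻¹) - m * ((y * M⁻¹ : ℝ) : ℂ)) := by
    simp only [twistRemainder, hA, hΦ.prim_period]
    push_cast
    field_simp
    ring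
  have hy : ‖1 + (stdAddChar κ - 1) * (y : ℂ)‖ ≤ 1 := norm_one_add_sub_one_mul_le
    (AddChar.norm_apply _ _).le ⟨Int.fract_nonneg _, (Int.fract_lt_one _).le⟩
  calc ‖twistRemainder κ M Φ x‖ ≤ ‖A‖ * ‖1 + (stdAddChar κ - 1) * (y : ℂ)‖ + M⁻¹ * N / 2 := by
        rw [hsplit, ← norm_mul]
        exact norm_add_le_of_le le_rfl (hΦ.norm_prim_sub_mul_le hMinv _)
    _ ≤ ‖A‖ * 1 + M⁻¹ * N / 2 := by gcongr
    _ ≤ M⁻¹ * (sinConst b * ‖m‖) + M⁻¹ * N / 2 := by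
        rw [mul_one]
        gcongr
        exact hΦ.norm_prim_mul_inv_le hb hκ hM
    _ = M⁻¹ * (sinConst b * ‖m‖ + N / 2) := by ring

lemma HasMeanOsc.bddMeasurable_twistRemainder (hb : 2 ≤ b) (hκ : κ ≠ 0) (hM : 0 < M)
    (hΦ : HasMeanOsc Φ M⁻¹ m N) : BddMeasurable (twistRemainder κ M Φ) :=
  ⟨measurable_const.add (hΦ.bddMeasurable.continuous_prim.measurable.comp
    ((measurable_fract.comp (measurable_id.mul_const M)).mul_const _)), _,
    hΦ.norm_twistRemainder_le hb hκ hM⟩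

/-- The primitive of a twisted function is a twisted function plus a constant; since twisted
functions have mean zero, that constant is the mean of the primitive. -/
lemma HasMeanOsc.prim_twist (hb : 2 ≤ b) (hκ : κ ≠ 0) (hM : 0 < M) (hΦ : HasMeanOsc Φ M⁻¹ m N) :
    ∃ m' : ℂ, ‖m'‖ ≤ M⁻¹ * (sinConst b * ‖m‖) ∧
      HasMeanOsc (prim (twist κ M Φ)) (b * M⁻¹) m' (M⁻¹ * (sinConst b * ‖m‖ + N / 2)) := by
  have hprim : ∀ x, prim (twist κ M Φ) x - -(prim Φ M⁻¹ * (stdAddChar κ - 1)⁻¹)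
      = twist κ M (twistRemainder κ M Φ) x := fun x => by
    rw [QMC.prim_twist hκ hM hΦ.periodic hΦ.bddMeasurable]
    ring
  have hbdd := hΦ.bddMeasurable.twist κ M
  have hperiod := prim_twist_period hκ hM hΦ.periodic hΦ.bddMeasurable
  have hper := periodic_twist hM hΦ.periodic κ
  have hbM : (0 : ℝ) < b * M⁻¹ := mul_pos (by exact_mod_cast NeZero.pos b) (inv_pos.mpr hM)
  have hP := hbdd.prim_of_periodic hbM hper hperiod
  refine ⟨-(prim Φ M⁻¹ * (stdAddChar κ - 1)⁻¹), ?_, hP, hbdd.periodic_prim hper hperiod, ?_,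
    fun x => ?_⟩
  · rw [norm_neg]
    exact hΦ.norm_prim_mul_inv_le hb hκ hM
  · rw [← sub_eq_zero, ← hP.prim_sub_const, funext hprim]
    exact prim_twist_period hκ hM (periodic_twistRemainder hM κ Φ)
      (hΦ.bddMeasurable_twistRemainder hb hκ hM)
  · rw [hprim, norm_twist]
    exact hΦ.norm_twistRemainder_le hb hκ hM x

end Twist

/-! ### Digits and the leading-digit recursion -/

section Digits
variable {b : ℕ}

lemma natDigit_eq_zero_of_lt {k i : ℕ} (h : k < b ^ i) : natDigit b k i = 0 := by
  simp [natDigit, Nat.div_eq_of_lt h]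

lemma natDigit_leading_add_of_lt {κ K a i : ℕ} (hi : i < a) :
    natDigit b (κ * b ^ a + K) i = natDigit b K i := by
  obtain ⟨d, rfl⟩ := Nat.exists_eq_add_of_lt hi
  rcases Nat.eq_zero_or_pos (b ^ i) with h0 | hpos
  · simp [natDigit, h0]
  · rw [natDigit, natDigit,
      show κ * b ^ (i + d + 1) + K = K + b ^ i * (b * (κ * b ^ d)) by ring,
      Nat.add_mul_div_left _ _ hpos, Nat.add_mul_mod_self_left]

lemma natDigit_leading_add {κ K a : ℕ} (hκ : κ < b) (hK : K < b ^ a) :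
    natDigit b (κ * b ^ a + K) a = κ := by
  rw [natDigit, add_comm, Nat.add_mul_div_right _ _ (by omega), Nat.div_eq_of_lt hK, zero_add,
    Nat.mod_eq_of_lt hκ]

lemma leading_add_lt {κ K a : ℕ} (hκ : κ < b) (hK : K < b ^ a) :
    κ * b ^ a + K < b ^ (a + 1) := by
  have : (κ + 1) * b ^ a ≤ b * b ^ a := Nat.mul_le_mul_right _ hκ
  rw [pow_succ']
  linarith [add_mul κ 1 (b ^ a)]

lemma exists_eq_leading_add (hb : 2 ≤ b) {K : ℕ} (hK : K ≠ 0) :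
    ∃ κ a K' : ℕ, 0 < κ ∧ κ < b ∧ K' < b ^ a ∧ K = κ * b ^ a + K' := by
  have hpos : 0 < b ^ Nat.log b K := pow_pos (by omega) _
  refine ⟨K / b ^ Nat.log b K, Nat.log b K, K % b ^ Nat.log b K,
    Nat.div_pos (Nat.pow_log_le_self b hK) hpos, ?_, Nat.mod_lt _ hpos, (Nat.div_add_mod' K _).symm⟩
  rw [Nat.div_lt_iff_lt_mul hpos, ← pow_succ']
  exact Nat.lt_pow_succ_log_self (by omega) K

lemma mem_digitPositions (hb : 2 ≤ b) {k p : ℕ} :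
    p ∈ digitPositions b k ↔ 1 ≤ p ∧ natDigit b k (p - 1) ≠ 0 := by
  rw [digitPositions, Finset.mem_filter, Finset.mem_Icc, and_congr_left_iff]
  refine fun hp => and_iff_left_of_imp fun _ => ?_
  by_contra! h
  exact hp (natDigit_eq_zero_of_lt ((Nat.lt_pow_self (by omega : 1 < b)).trans_le
    (Nat.pow_le_pow_right (by omega) (by omega))))

lemma le_of_mem_digitPositions (hb : 2 ≤ b) {k a p : ℕ} (hk : k < b ^ a)
    (hp : p ∈ digitPositions b k) : p ≤ a := by
  by_contra! h
  exact ((mem_digitPositions hb).mp hp).2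
    (natDigit_eq_zero_of_lt (hk.trans_le (Nat.pow_le_pow_right (by omega) (by omega))))

@[simp] lemma digitPositions_zero : digitPositions b 0 = ∅ := by simp [digitPositions]

@[simp] lemma mu_zero_left (k : ℕ) : mu 0 b k = 0 := by simp [mu]

@[simp] lemma mu_zero_right (n : ℕ) : mu n b 0 = 0 := by simp [mu]

section Leading
variable (hb : 2 ≤ b) {κ K a : ℕ} (hκ0 : 0 < κ) (hκ : κ < b) (hK : K < b ^ a)
include hb hK

lemma succ_notMem_digitPositions : a + 1 ∉ digitPositions b K := fun h => by
  have := le_of_mem_digitPositions hb hK h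
  omega

include hκ0 hκ

lemma digitPositions_leading_add :
    digitPositions b (κ * b ^ a + K) = insert (a + 1) (digitPositions b K) := by
  have hzero {k i : ℕ} (hk : k < b ^ (a + 1)) (hi : a < i) : natDigit b k i = 0 :=
    natDigit_eq_zero_of_lt (hk.trans_le (Nat.pow_le_pow_right (by omega) hi))
  ext p
  rw [Finset.mem_insert, mem_digitPositions hb, mem_digitPositions hb]
  rcases lt_trichotomy (p - 1) a with h | h | h
  · rw [natDigit_leading_add_of_lt h]
    exact ⟨Or.inr, fun h' => h'.resolve_left (by omega)⟩
  · rw [h, natDigit_leading_add hκ hK, natDigit_eq_zero_of_lt hK]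
    omega
  · rw [hzero (leading_add_lt hκ hK) h,
      hzero (hK.trans_le (Nat.pow_le_pow_right (by omega) (Nat.le_succ a))) h]
    omega

lemma mu_leading_add (n : ℕ) : mu (n + 1) b (κ * b ^ a + K) = (a + 1) + mu n b K := by
  rw [mu, digitPositions_leading_add hb hκ0 hκ hK, Finset.sort_insert, List.take_succ_cons,
    List.sum_cons, mu]
  · intro p hp
    have := le_of_mem_digitPositions hb hK hp
    omega
  · exact succ_notMem_digitPositions hb hK

lemma card_digitPositions_leading_add :
    (digitPositions b (κ * b ^ a + K)).card = (digitPositions b K).card + 1 := by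
  rw [digitPositions_leading_add hb hκ0 hκ hK,
    Finset.card_insert_of_notMem (succ_notMem_digitPositions hb hK)]

end Leading

lemma digitPositions_nonempty (hb : 2 ≤ b) {k : ℕ} (hk : k ≠ 0) :
    (digitPositions b k).Nonempty := by
  obtain ⟨κ, a, K, hκ0, hκ, hK, rfl⟩ := exists_eq_leading_add hb hk
  rw [digitPositions_leading_add hb hκ0 hκ hK]
  exact Finset.insert_nonempty _ _

end Digits

/-! ### Walsh functions -/

/-- The digit `ξ_{i+1}` of `x = ξ_0 + ξ_1 b⁻¹ + ξ_2 b⁻² + ⋯`, as an element of `ℤ_b`. Of the two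
expansions of a `b`-adic fraction the finite one is used. -/
def realDigit (b : ℕ) (x : ℝ) (i : ℕ) : ZMod b := ((⌊x * (b : ℝ) ^ (i + 1)⌋ : ℤ) : ZMod b)

/-- The `k`-th Walsh function in base `b`, extended periodically to the real line. -/
def walsh (b : ℕ) [NeZero b] (k : ℕ) (x : ℝ) : ℂ :=
  stdAddChar (∑ i ∈ Finset.range k, (natDigit b k i : ZMod b) * realDigit b x i)

section Walsh
variable {b : ℕ} [NeZero b]

omit [NeZero b] in
lemma sum_range_natDigit_mul (hb : 2 ≤ b) {k l : ℕ} (h : k < b ^ l) (f : ℕ → ZMod b) :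
    ∑ i ∈ Finset.range k, (natDigit b k i : ZMod b) * f i
      = ∑ i ∈ Finset.range l, (natDigit b k i : ZMod b) * f i := by
  have hext : ∀ n n' : ℕ, n ≤ n' → k < b ^ n →
      ∑ i ∈ Finset.range n, (natDigit b k i : ZMod b) * f i
        = ∑ i ∈ Finset.range n', (natDigit b k i : ZMod b) * f i := by
    intro n n' hn hk
    refine Finset.sum_subset (Finset.range_mono hn) fun i _ hi => ?_
    rw [natDigit_eq_zero_of_lt (hk.trans_le (Nat.pow_le_pow_right (by omega) (by simpa using hi)))]
    simp
  have hk : k < b ^ k := Nat.lt_pow_self (by omega)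
  rcases le_total k l with hkl | hlk
  · exact hext k l hkl hk
  · exact (hext l k hlk h).symm

lemma walsh_eq_of_lt (hb : 2 ≤ b) {k l : ℕ} (h : k < b ^ l) (x : ℝ) :
    walsh b k x
      = stdAddChar (∑ i ∈ Finset.range l, (natDigit b k i : ZMod b) * realDigit b x i) := by
  rw [walsh, sum_range_natDigit_mul hb h]

@[simp] lemma walsh_zero (x : ℝ) : walsh b 0 x = 1 := by simp [walsh]

@[simp] lemma norm_walsh (k : ℕ) (x : ℝ) : ‖walsh b k x‖ = 1 := AddChar.norm_apply _ _

lemma walsh_leading_add (hb : 2 ≤ b) {κ K a : ℕ} (hκ : κ < b) (hK : K < b ^ a) (x : ℝ) :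
    walsh b (κ * b ^ a + K) x
      = walsh b K x * stdAddChar ((κ : ZMod b) * realDigit b x a) := by
  rw [walsh_eq_of_lt hb (leading_add_lt hκ hK), walsh_eq_of_lt hb hK, Finset.sum_range_succ,
    natDigit_leading_add hκ hK, AddChar.map_add_eq_mul]
  congr 2
  refine Finset.sum_congr rfl fun i hi => ?_
  rw [natDigit_leading_add_of_lt (Finset.mem_range.mp hi)]

lemma exists_walsh_eq_step (hb : 2 ≤ b) {K a : ℕ} (hK : K < b ^ a) :
    ∃ s : ℤ → ℂ, (∀ n, ‖s n‖ ≤ 1) ∧ ∀ x, walsh b K x = s ⌊x * (b : ℝ) ^ a⌋ := by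
  refine ⟨fun n => stdAddChar (∑ i ∈ Finset.range a,
    (natDigit b K i : ZMod b) * ((n / ((b ^ (a - 1 - i) : ℕ) : ℤ) : ℤ) : ZMod b)),
    fun n => (AddChar.norm_apply _ _).le, fun x => ?_⟩
  rw [walsh_eq_of_lt hb hK]
  congr 1
  refine Finset.sum_congr rfl fun i hi => ?_
  have hb0 : (b : ℝ) ≠ 0 := by exact_mod_cast NeZero.ne b
  obtain ⟨d, rfl⟩ := Nat.exists_eq_add_of_lt (Finset.mem_range.mp hi)
  rw [realDigit, ← Int.floor_div_natCast, show i + d + 1 - 1 - i = d by omega, Nat.cast_pow]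
  congr 3
  rw [eq_div_iff (pow_ne_zero _ hb0)]
  ring

lemma bddMeasurable_walsh (hb : 2 ≤ b) (K : ℕ) : BddMeasurable (walsh b K) := by
  obtain ⟨s, hs1, hs⟩ := exists_walsh_eq_step hb (Nat.lt_pow_self (by omega : 1 < b) : K < b ^ K)
  rw [funext hs]
  exact bddMeasurable_step ⟨1, hs1⟩ _

lemma inv_pow_eq_mul_inv_pow_succ (a : ℕ) :
    ((b : ℝ) ^ a)⁻¹ = b * ((b : ℝ) ^ (a + 1))⁻¹ := by
  have : (b : ℝ) ≠ 0 := by exact_mod_cast NeZero.ne b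
  rw [pow_succ]
  field_simp

omit [NeZero b] in
lemma natCast_ne_zero_of_lt {κ : ℕ} (hκ0 : 0 < κ) (hκ : κ < b) : (κ : ZMod b) ≠ 0 := by
  rw [Ne, ZMod.natCast_eq_zero_iff]
  exact Nat.not_dvd_of_pos_of_lt hκ0 hκ

lemma pow_natCast_pos (a : ℕ) : 0 < (b : ℝ) ^ a := pow_pos (by exact_mod_cast NeZero.pos b) a

/-- The Walsh function of the remaining digits is constant on the cells over which the twist by the
leading digit has mean zero, so it factors out of the primitive. -/
lemma prim_walsh_mul (hb : 2 ≤ b) {κ K a : ℕ} (hκ0 : 0 < κ) (hκ : κ < b) (hK : K < b ^ a)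
    {Φ : ℝ → ℂ} (hΦ : BddMeasurable Φ) (hp : Function.Periodic Φ ((b : ℝ) ^ (a + 1))⁻¹) (x : ℝ) :
    prim (fun t => walsh b (κ * b ^ a + K) t * Φ t) x
      = walsh b K x * prim (twist (κ : ZMod b) ((b : ℝ) ^ (a + 1)) Φ) x := by
  have hM := pow_natCast_pos (b := b) (a + 1)
  obtain ⟨s, hs1, hs⟩ := exists_walsh_eq_step hb hK
  simp_rw [walsh_leading_add hb hκ hK, realDigit, hs, mul_assoc]
  refine prim_step_mul_of_prim_eq_zero (pow_natCast_pos a) ⟨1, hs1⟩ ?_ (hΦ.twist _ _) ?_ x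
  · rw [inv_pow_eq_mul_inv_pow_succ]
    exact periodic_twist hM hp _
  · rw [inv_pow_eq_mul_inv_pow_succ]
    exact prim_twist_period (natCast_ne_zero_of_lt hκ0 hκ) hM hp hΦ

lemma prim_walsh_mul_one (hb : 2 ≤ b) {κ K a : ℕ} (hκ0 : 0 < κ) (hκ : κ < b) (hK : K < b ^ a)
    {Φ : ℝ → ℂ} (hΦ : BddMeasurable Φ) (hp : Function.Periodic Φ ((b : ℝ) ^ (a + 1))⁻¹) :
    prim (fun t => walsh b (κ * b ^ a + K) t * Φ t) 1 = 0 := by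
  have hM := pow_natCast_pos (b := b) (a + 1)
  have hP := (hΦ.twist (κ : ZMod b) _).periodic_prim (periodic_twist hM hp _)
    (prim_twist_period (natCast_ne_zero_of_lt hκ0 hκ) hM hp hΦ)
  have h1 := hP.nat_mul_eq (b ^ a)
  rw [← inv_pow_eq_mul_inv_pow_succ, Nat.cast_pow, mul_inv_cancel₀ (pow_natCast_pos a).ne',
    prim_zero] at h1
  rw [prim_walsh_mul hb hκ0 hκ hK hΦ hp, h1, mul_zero]

lemma prim_walsh_one (hb : 2 ≤ b) {k : ℕ} (hk : k ≠ 0) : prim (walsh b k) 1 = 0 := by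
  obtain ⟨κ, a, K, hκ0, hκ, hK, rfl⟩ := exists_eq_leading_add hb hk
  simpa using prim_walsh_mul_one hb hκ0 hκ hK (bddMeasurable_const 1) (fun _ => rfl)

omit [NeZero b] in
lemma realDigit_natCast_add (n : ℕ) (x : ℝ) (i : ℕ) : realDigit b (n + x) i = realDigit b x i := by
  rw [realDigit, realDigit, add_mul, ← Nat.cast_pow, ← Nat.cast_mul, Int.floor_natCast_add]
  simp

lemma periodic_walsh (b : ℕ) [NeZero b] (k : ℕ) : Function.Periodic (walsh b k) 1 := fun x => by
  have hdigit (i : ℕ) : realDigit b (x + 1) i = realDigit b x i := by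
    simpa [add_comm] using realDigit_natCast_add 1 x i
  simp only [walsh, hdigit]

end Walsh

/-! ### Iterated primitives of Walsh functions -/

/-- The cost of `n` integrations by parts against `f`: repeatedly split off the mean over `[0,1]`
and pass to the primitive of the rest; the moduli of the means and the sup norm of the last
remainder are added up. -/
def primNorm : ℕ → (ℝ → ℂ) → ℝ≥0∞
  | 0, f => ⨆ x, ‖f x‖ₑ
  | n + 1, f => ‖prim f 1‖ₑ + primNorm n (prim fun x => f x - prim f 1)

lemma primNorm_succ_of_prim_eq_zero {f : ℝ → ℂ} (h0 : prim f 1 = 0) (n : ℕ) :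
    primNorm (n + 1) f = primNorm n (prim f) := by
  simp [primNorm, h0]

lemma iSup_enorm_le_ofReal {f : ℝ → ℂ} {B : ℝ} (h : ∀ x, ‖f x‖ ≤ B) :
    ⨆ x, ‖f x‖ₑ ≤ ENNReal.ofReal B :=
  iSup_le fun x => (ofReal_norm (f x)).symm.trans_le (ENNReal.ofReal_le_ofReal (h x))

lemma HasMeanOsc.norm_le {f : ℝ → ℂ} {ℓ : ℝ} {m : ℂ} {N : ℝ} (hf : HasMeanOsc f ℓ m N) (x : ℝ) :
    ‖f x‖ ≤ ‖m‖ + N := by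
  rw [← add_sub_cancel m (f x)]
  exact norm_add_le_of_le le_rfl (hf.norm_sub_le x)

/-- Each integration halves the oscillation, so the bound is a telescoping geometric sum. -/
lemma HasMeanOsc.primNorm_le {f : ℝ → ℂ} {m : ℂ} {N : ℝ} (hf : HasMeanOsc f 1 m N) (n : ℕ) :
    primNorm n f ≤ ENNReal.ofReal (‖m‖ + N) := by
  induction n generalizing f m N with
  | zero => exact iSup_enorm_le_ofReal hf.norm_le
  | succ n ih =>
    obtain ⟨hc, hprim⟩ := hf.sub_mean.prim_of_mean_zero
    have hmean : prim f 1 = m := by simpa using hf.prim_period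
    rw [primNorm, hmean, ENNReal.ofReal_add (norm_nonneg m) hf.nonneg, ofReal_norm]
    gcongr
    exact (ih hprim).trans (ENNReal.ofReal_le_ofReal (by linarith))

section PeriodMultiple
variable {f : ℝ → ℂ} {ℓ : ℝ} {m : ℂ} {N : ℝ}

lemma HasMeanOsc.natCast_mul (hf : HasMeanOsc f ℓ m N) (n : ℕ) :
    HasMeanOsc f (n * ℓ) m N := by
  refine ⟨hf.bddMeasurable, hf.periodic.nat_mul n, ?_, hf.norm_sub_le⟩
  have h := hf.periodic.intervalIntegral_add_zsmul_eq (n : ℤ) 0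
    fun _ _ => hf.bddMeasurable.intervalIntegrable _ _
  simp only [zero_add, zsmul_eq_mul, Int.cast_natCast] at h
  calc prim f (n * ℓ) = n * prim f ℓ := h
    _ = m * ((n * ℓ : ℝ) : ℂ) := by
      rw [hf.prim_period]
      push_cast
      ring

lemma HasMeanOsc.inv_pow_of_le {b a a' : ℕ} [NeZero b] (hf : HasMeanOsc f ((b : ℝ) ^ a)⁻¹ m N)
    (h : a' ≤ a) : HasMeanOsc f ((b : ℝ) ^ a')⁻¹ m N := by
  have hb0 : (b : ℝ) ≠ 0 := by exact_mod_cast NeZero.ne b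
  have hdvd : ((b : ℝ) ^ a')⁻¹ = (b ^ (a - a') : ℕ) * ((b : ℝ) ^ a)⁻¹ := by
    rw [← Nat.sub_add_cancel h, pow_add, Nat.add_sub_cancel]
    push_cast
    field_simp
  rw [hdvd]
  exact hf.natCast_mul _

end PeriodMultiple

/-- The bound for `primNorm`, up to the factor `b ^ (-μ)`, of a Walsh function with `ρ` nonzero
digits times a function with mean `m` and oscillation `N`. -/
def walshBound (b ρ : ℕ) (m N : ℝ) : ℝ :=
  sinConst b ^ ρ * (1 + ∑ j ∈ Finset.range ρ, Real.sin (Real.pi / b) ^ j) * m + N / 2 ^ ρ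

section WalshBound
variable {b : ℕ} (hb : 2 ≤ b)
include hb

lemma walshBound_succ (ρ : ℕ) (c m N : ℝ) :
    walshBound b ρ (c * (sinConst b * m)) (c * (sinConst b * m + N / 2))
      = c * walshBound b (ρ + 1) m N := by
  have hsin := (sin_pi_div_pos hb).ne'
  have hmul : sinConst b * Real.sin (Real.pi / b) = 1 / 2 := by
    rw [sinConst]
    field_simp
  have hpow : sinConst b ^ ρ * Real.sin (Real.pi / b) ^ ρ = 1 / 2 ^ ρ := by
    rw [← mul_pow, hmul, one_div_pow]
  unfold walshBound
  rw [Finset.sum_range_succ, pow_succ, pow_succ]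
  linear_combination (-(c * sinConst b * m)) * hpow

lemma walshBound_le_walshBound {m m' : ℝ} (h : m ≤ m') (ρ : ℕ) (N : ℝ) :
    walshBound b ρ m N ≤ walshBound b ρ m' N := by
  have := sinConst_pos hb
  have := sin_pi_div_pos hb
  unfold walshBound
  gcongr

variable [NeZero b]

/-- Each integration removes the leading digit of `K`, at the expense of replacing `Φ` by the
primitive of its twist. -/
lemma HasMeanOsc.primNorm_walsh_mul_le (n : ℕ) {K a : ℕ} (hK : K < b ^ a)
    {Φ : ℝ → ℂ} {m : ℂ} {N : ℝ} (hΦ : HasMeanOsc Φ ((b : ℝ) ^ a)⁻¹ m N) :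
    primNorm n (fun x => walsh b K x * Φ x) ≤ ENNReal.ofReal
      ((b : ℝ)⁻¹ ^ mu n b K * walshBound b (min n (digitPositions b K).card) ‖m‖ N) := by
  induction n generalizing K a Φ m N with
  | zero =>
    refine iSup_enorm_le_ofReal fun x => ?_
    simpa [walshBound] using hΦ.norm_le x
  | succ n ih =>
    rcases eq_or_ne K 0 with rfl | hK0
    · have h1 : HasMeanOsc Φ 1 m N := by simpa using hΦ.inv_pow_of_le (Nat.zero_le a)
      simpa [walshBound] using h1.primNorm_le (n + 1)
    obtain ⟨κ, a', K', hκ0, hκ, hK', rfl⟩ := exists_eq_leading_add hb hK0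
    have ha : a' < a := by
      refine (Nat.pow_lt_pow_iff_right hb).mp (lt_of_le_of_lt ?_ hK)
      exact Nat.le_add_right_of_le (Nat.le_mul_of_pos_left _ hκ0)
    have hΦ' := hΦ.inv_pow_of_le ha
    obtain ⟨m', hm', hprim⟩ := hΦ'.prim_twist hb (natCast_ne_zero_of_lt hκ0 hκ)
      (pow_natCast_pos (a' + 1))
    rw [← inv_pow_eq_mul_inv_pow_succ] at hprim
    rw [primNorm_succ_of_prim_eq_zero (prim_walsh_mul_one hb hκ0 hκ hK' hΦ'.bddMeasurable
        hΦ'.periodic), funext (prim_walsh_mul hb hκ0 hκ hK' hΦ'.bddMeasurable hΦ'.periodic)]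
    refine (ih hK' hprim).trans (ENNReal.ofReal_le_ofReal ?_)
    rw [mu_leading_add hb hκ0 hκ hK', card_digitPositions_leading_add hb hκ0 hκ hK',
      Nat.add_min_add_right, add_comm (a' + 1), pow_add _ (mu n b K'), mul_assoc,
      inv_pow _ (a' + 1), ← walshBound_succ hb]
    gcongr
    exact walshBound_le_walshBound hb hm' _ _

end WalshBound

section WalshConst
variable {α b ρ : ℕ}

lemma one_div_pow_le_fold_max (hρ : 1 ≤ ρ) (hρα : ρ ≤ α) {t : ℝ} (ht : 0 < t) :
    (1 / t) ^ ρ ≤ (Finset.Icc 1 (α - 1)).fold max (2 / t ^ α) (fun z => 1 / t ^ z) := by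
  rw [Finset.le_fold_max, one_div_pow]
  rcases hρα.eq_or_lt with rfl | h
  · left
    gcongr
    norm_num
  · exact .inr ⟨ρ, Finset.mem_Icc.mpr ⟨hρ, by omega⟩, le_rfl⟩

/-- For `b ≤ 5` the sum has at most `n + 2` terms, each at most `1`; for `b ≥ 5` it is dominated by
a geometric series of ratio `3 / 4`. -/
lemma one_add_sum_sin_pow_le (hb : 2 ≤ b) {n : ℕ} (hρ : ρ ≤ n + 2) :
    1 + ∑ j ∈ Finset.range ρ, Real.sin (Real.pi / b) ^ j ≤ (1 + n * (1 / (b : ℝ))) * 5 := by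
  have hs := sin_pi_div_pos hb
  rcases le_total b 5 with h | h
  · have hsum : ∑ j ∈ Finset.range ρ, Real.sin (Real.pi / b) ^ j ≤ ρ :=
      (Finset.sum_le_card_nsmul _ _ 1 fun j _ =>
        pow_le_one₀ hs.le (Real.sin_le_one _)).trans (by simp)
    have hρ' : (ρ : ℝ) ≤ n + 2 := by exact_mod_cast hρ
    have hinv : 1 ≤ 1 / (b : ℝ) * 5 := by
      rw [one_div_mul_eq_div, le_div_iff₀ (by positivity), one_mul]
      exact_mod_cast h
    nlinarith [(Nat.cast_nonneg n : (0 : ℝ) ≤ n)]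
  · have h' : (5 : ℝ) ≤ b := by exact_mod_cast h
    have hsin : Real.sin (Real.pi / b) ≤ 3 / 4 := by
      refine (Real.sin_le (by positivity)).trans ?_
      rw [div_le_div_iff₀ (by linarith) (by norm_num)]
      nlinarith [Real.pi_lt_d2]
    have hsum : ∑ j ∈ Finset.range ρ, Real.sin (Real.pi / b) ^ j ≤ 4 := by
      calc ∑ j ∈ Finset.range ρ, Real.sin (Real.pi / b) ^ j
          ≤ ∑ j ∈ Finset.range ρ, (3 / 4 : ℝ) ^ j := by gcongr
        _ = (1 - (3 / 4 : ℝ) ^ ρ) * 4 := by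
          rw [geom_sum_eq (by norm_num)]
          ring
        _ ≤ 4 := by linarith [pow_nonneg (by norm_num : (0 : ℝ) ≤ 3 / 4) ρ]
    have : 0 ≤ (n : ℝ) * (1 / (b : ℝ)) := by positivity
    linarith

lemma one_add_mul_five_le (hb : 2 ≤ b) (n : ℕ) :
    (1 + n * (1 / (b : ℝ))) * 5
      ≤ (1 + 1 / (b : ℝ) + 1 / ((b : ℝ) * ((b : ℝ) + 1))) ^ n
        * (3 + 2 / (b : ℝ) + (2 * (b : ℝ) + 1) / ((b : ℝ) - 1)) := by
  have hb' : (2 : ℝ) ≤ b := by exact_mod_cast hb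
  have hinv : 0 ≤ 1 / (b : ℝ) := by positivity
  gcongr ?_ * ?_
  · refine (one_add_mul_le_pow (a := 1 / (b : ℝ)) (by linarith) n).trans ?_
    exact pow_le_pow_left₀ (by positivity) (le_add_of_nonneg_right (by positivity)) n
  · have h2 : 2 ≤ (2 * (b : ℝ) + 1) / ((b : ℝ) - 1) := by
      rw [le_div_iff₀ (by linarith)]
      linarith
    have : 0 ≤ 2 / (b : ℝ) := by positivity
    linarith

lemma walshBound_le_walshConst (hb : 2 ≤ b) (hα : 2 ≤ α) (hρ : 1 ≤ ρ) (hρα : ρ ≤ α) :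
    walshBound b ρ 1 0 ≤ walshConst α b := by
  have hs := sin_pi_div_pos hb
  have hpow := one_div_pow_le_fold_max hρ hρα (t := 2 * Real.sin (Real.pi / b)) (by positivity)
  rw [walshBound, walshConst, mul_assoc (Finset.fold _ _ _ _), mul_one, zero_div, add_zero]
  refine mul_le_mul hpow ?_ (by positivity) (le_trans (by positivity) hpow)
  exact (one_add_sum_sin_pow_le hb (by omega)).trans (one_add_mul_five_le hb (α - 2))

lemma primNorm_walsh_le [NeZero b] (hb : 2 ≤ b) (hα : 2 ≤ α) {k : ℕ} (hk : k ≠ 0) :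
    primNorm α (walsh b k) ≤ ENNReal.ofReal (walshConst α b) * (b : ℝ≥0∞)⁻¹ ^ mu α b k := by
  have hρ : 1 ≤ min α (digitPositions b k).card :=
    le_min (by omega) (Finset.card_pos.mpr (digitPositions_nonempty hb hk))
  have hb0 : (0 : ℝ) < b := by positivity
  have h := (hasMeanOsc_const 1 _).primNorm_walsh_mul_le hb α
    (Nat.lt_pow_self (by omega : 1 < b) : k < b ^ k)
  simp only [mul_one, norm_one] at h
  refine h.trans ?_
  rw [ENNReal.ofReal_mul (by positivity), ENNReal.ofReal_pow (by positivity),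
    ENNReal.ofReal_inv_of_pos hb0, ENNReal.ofReal_natCast, mul_comm]
  gcongr
  exact walshBound_le_walshConst hb hα hρ (min_le_left _ _)

end WalshConst

/-! ### Approximation by test functions -/

/-- Smooth functions on the line with compact support in the open unit interval. -/
structure IsTest (f : ℝ → ℂ) : Prop where
  contDiff : ContDiff ℝ ∞ f
  exists_support_subset : ∃ δ : ℝ, 0 < δ ∧ Function.support f ⊆ Set.Icc δ (1 - δ)

/-- Approximation of `f` by test functions in the sense of the dominated convergence theorem on
`[0,1]`: uniformly bounded and almost everywhere. -/
structure IsTestApprox (g : ℕ → ℝ → ℂ) (f : ℝ → ℂ) : Prop where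
  isTest : ∀ n, IsTest (g n)
  exists_bound : ∃ C : ℝ, ∀ n x, ‖g n x‖ ≤ C
  tendsto : ∀ᵐ x ∂(volume.restrict (Set.Icc (0 : ℝ) 1)),
    Filter.Tendsto (fun n => g n x) Filter.atTop (nhds (f x))

section IsTest
variable {f g : ℝ → ℂ}

lemma IsTest.bddMeasurable (hf : IsTest f) : BddMeasurable f := by
  obtain ⟨δ, -, hδ⟩ := hf.exists_support_subset
  exact ⟨hf.contDiff.continuous.measurable, hf.contDiff.continuous.bounded_above_of_compact_support
    (HasCompactSupport.of_support_subset_isCompact isCompact_Icc hδ)⟩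

lemma IsTest.const_mul (hf : IsTest f) (c : ℂ) : IsTest fun x => c * f x := by
  obtain ⟨δ, hδ0, hδ⟩ := hf.exists_support_subset
  exact ⟨contDiff_const.mul hf.contDiff, δ, hδ0, (Function.support_mul_subset_right _ f).trans hδ⟩

lemma IsTest.sub (hf : IsTest f) (hg : IsTest g) : IsTest fun x => f x - g x := by
  obtain ⟨δ, hδ0, hδ⟩ := hf.exists_support_subset
  obtain ⟨ε, hε0, hε⟩ := hg.exists_support_subset
  refine ⟨hf.contDiff.sub hg.contDiff, min δ ε, lt_min hδ0 hε0, ?_⟩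
  have hmono : ∀ {η : ℝ}, min δ ε ≤ η → Set.Icc η (1 - η) ⊆ Set.Icc (min δ ε) (1 - min δ ε) :=
    fun h => Set.Icc_subset_Icc h (by linarith)
  exact (Function.support_sub f g).trans (Set.union_subset (hδ.trans (hmono (min_le_left _ _)))
    (hε.trans (hmono (min_le_right _ _))))

lemma hasDerivAt_prim (hf : Continuous f) (x : ℝ) : HasDerivAt (prim f) (f x) x :=
  intervalIntegral.integral_hasDerivAt_right (hf.intervalIntegrable _ _)
    (hf.stronglyMeasurableAtFilter _ _) hf.continuousAt

lemma deriv_prim (hf : Continuous f) : deriv (prim f) = f :=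
  funext fun x => (hasDerivAt_prim hf x).deriv

lemma IsTest.prim (hf : IsTest f) (h1 : prim f 1 = 0) : IsTest (prim f) := by
  obtain ⟨δ, hδ0, hδ⟩ := hf.exists_support_subset
  have hcont := hf.contDiff.continuous
  refine ⟨?_, δ, hδ0, fun x hx => ?_⟩
  · rw [contDiff_infty_iff_deriv, deriv_prim hcont]
    exact ⟨fun x => (hasDerivAt_prim hcont x).differentiableAt, hf.contDiff⟩
  have hzero : ∀ u v : ℝ, (∀ t ∈ Set.uIoc u v, t ∉ Set.Icc δ (1 - δ)) → ∫ t in u..v, f t = 0 :=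
    fun u v h => intervalIntegral.integral_zero_ae
      (.of_forall fun t ht => Function.notMem_support.mp fun h' => h t ht (hδ h'))
  constructor <;> by_contra! hlt <;> apply hx
  · exact hzero 0 x fun t ht h => by linarith [h.1, ht.2.trans_lt (max_lt hδ0 hlt)]
  · have hx1 := hf.bddMeasurable.prim_add_integral x 1
    rwa [hzero x 1 fun t ht h => by linarith [h.2, (lt_min hlt (by linarith)).trans ht.1],
      add_zero, h1] at hx1

end IsTest

/-- Smooth cut-off functions exhausting the open unit interval. -/
def cutoff (n : ℕ) : ContDiffBump (1 / 2 : ℝ) where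
  rIn := 1 / 2 - 2 * (1 / ((n : ℝ) + 5))
  rOut := 1 / 2 - 1 / ((n : ℝ) + 5)
  rIn_pos := by
    have : 1 / ((n : ℝ) + 5) < 1 / 4 :=
      one_div_lt_one_div_of_lt (by norm_num) (by linarith [Nat.cast_nonneg (α := ℝ) n])
    linarith
  rIn_lt_rOut := by
    have : 0 < 1 / ((n : ℝ) + 5) := by positivity
    linarith

lemma support_cutoff_subset (n : ℕ) :
    Function.support (cutoff n) ⊆ Set.Icc (1 / ((n : ℝ) + 5)) (1 - 1 / ((n : ℝ) + 5)) := by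
  rw [(cutoff n).support_eq, Real.ball_eq_Ioo]
  refine Set.Ioo_subset_Icc_self.trans (Set.Icc_subset_Icc ?_ ?_) <;>
  · simp only [cutoff]
    linarith

lemma tendsto_cutoff {x : ℝ} (hx : x ∈ Set.Ioo (0 : ℝ) 1) :
    Filter.Tendsto (fun n => cutoff n x) Filter.atTop (nhds 1) := by
  have h : Filter.Tendsto (fun n : ℕ => 1 / ((n : ℝ) + 5)) Filter.atTop (nhds 0) :=
    Filter.Tendsto.div_atTop tendsto_const_nhds
      (Filter.tendsto_atTop_add_const_right _ _ tendsto_natCast_atTop_atTop)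
  refine tendsto_const_nhds.congr' ?_
  filter_upwards [h.eventually_lt_const (half_pos hx.1),
    h.eventually_lt_const (half_pos (sub_pos.mpr hx.2))] with n hn hn'
  refine ((cutoff n).one_of_mem_closedBall ?_).symm
  rw [Real.closedBall_eq_Icc]
  simp only [cutoff]
  constructor <;> linarith

lemma BddMeasurable.exists_contDiff_approx {f : ℝ → ℂ} (hf : BddMeasurable f) :
    ∃ k : ℕ → ℝ → ℂ, (∀ n, ContDiff ℝ ∞ (k n)) ∧ (∃ C : ℝ, ∀ n x, ‖k n x‖ ≤ C) ∧
      ∀ᵐ x, Filter.Tendsto (fun n => k n x) Filter.atTop (nhds (f x)) := by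
  obtain ⟨hfm, C, hC⟩ := hf
  have hC0 : 0 ≤ C := (norm_nonneg _).trans (hC 0)
  have hloc : LocallyIntegrable f volume :=
    (locallyIntegrable_const C).mono hfm.aestronglyMeasurable
      (.of_forall fun x => (hC x).trans (le_abs_self C))
  let ψ (n : ℕ) : ContDiffBump (0 : ℝ) :=
    ⟨1 / ((n : ℝ) + 1), 2 * (1 / ((n : ℝ) + 1)), by positivity,
      lt_mul_of_one_lt_left (by positivity) one_lt_two⟩
  refine ⟨fun n => convolution ((ψ n).normed volume) f (ContinuousLinearMap.lsmul ℝ ℝ) volume,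
    fun n => (ψ n).hasCompactSupport_normed.contDiff_convolution_left _ (ψ n).contDiff_normed hloc,
    ⟨C, fun n x => ?_⟩, ?_⟩
  · simpa using dist_convolution_le (f := (ψ n).normed volume) (g := f) (x₀ := x) (z₀ := 0)
      (R := (ψ n).rOut) (μ := volume) hC0 (by rw [ContDiffBump.support_normed_eq])
      (ψ n).nonneg_normed (ψ n).integral_normed hfm.aestronglyMeasurable
      (fun y _ => by simpa using hC y)
  · refine ContDiffBump.ae_convolution_tendsto_right_of_locallyIntegrable (K := 2) ?_
      (.of_forall fun n => le_rfl) hloc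
    simpa [ψ] using (tendsto_one_div_add_atTop_nhds_zero_nat (𝕜 := ℝ)).const_mul 2

section IsTestApprox
variable {f : ℝ → ℂ} {g : ℕ → ℝ → ℂ}

lemma BddMeasurable.exists_isTestApprox (hf : BddMeasurable f) :
    ∃ g : ℕ → ℝ → ℂ, IsTestApprox g f := by
  obtain ⟨k, hk, ⟨C, hC⟩, hlim⟩ := hf.exists_contDiff_approx
  refine ⟨fun n x => (cutoff n x : ℂ) * k n x, fun n => ⟨?_, 1 / ((n : ℝ) + 5), by positivity, ?_⟩,
    ⟨C, fun n x => ?_⟩, ?_⟩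
  · exact (Complex.ofRealCLM.contDiff.comp (cutoff n).contDiff).mul (hk n)
  · refine fun x hx => support_cutoff_subset n fun h => hx ?_
    simp [h]
  · rw [norm_mul, Complex.norm_real, Real.norm_of_nonneg (cutoff n).nonneg]
    exact (mul_le_of_le_one_left (norm_nonneg _) (cutoff n).le_one).trans (hC n x)
  · rw [← restrict_Ioo_eq_restrict_Icc, ae_restrict_iff' measurableSet_Ioo]
    filter_upwards [hlim] with x hx hmem
    simpa using ((Complex.continuous_ofReal.tendsto _).comp (tendsto_cutoff hmem)).mul hx

lemma IsTestApprox.tendsto_prim (hg : IsTestApprox g f) {x : ℝ} (hx : x ∈ Set.Icc (0 : ℝ) 1) :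
    Filter.Tendsto (fun n => prim (g n) x) Filter.atTop (nhds (prim f x)) := by
  obtain ⟨C, hC⟩ := hg.exists_bound
  refine intervalIntegral.tendsto_integral_filter_of_dominated_convergence (fun _ => C)
    (.of_forall fun n => (hg.isTest n).bddMeasurable.measurable.aestronglyMeasurable)
    (.of_forall fun n => .of_forall fun t _ => hC n t) intervalIntegrable_const ?_
  filter_upwards [(ae_restrict_iff' measurableSet_Icc).mp hg.tendsto] with t ht hmem
  rw [Set.uIoc_of_le hx.1] at hmem
  exact ht ⟨hmem.1.le, hmem.2.trans hx.2⟩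

lemma exists_isTest_prim_eq_one : ∃ η : ℝ → ℂ, IsTest η ∧ prim η 1 = 1 := by
  obtain ⟨g, hg⟩ := (bddMeasurable_const 1).exists_isTestApprox
  have hlim := hg.tendsto_prim (Set.right_mem_Icc.mpr zero_le_one)
  obtain ⟨n, hn⟩ := (hlim.eventually_ne (by simp : prim (fun _ => 1) 1 ≠ 0)).exists
  refine ⟨_, (hg.isTest n).const_mul (prim (g n) 1)⁻¹, ?_⟩
  rw [prim, intervalIntegral.integral_const_mul]
  exact inv_mul_cancel₀ hn

/-- The means of the approximating functions are corrected by multiples of a fixed bump. -/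
lemma BddMeasurable.exists_isTestApprox_mean_zero (hf : BddMeasurable f) (h0 : prim f 1 = 0) :
    ∃ g : ℕ → ℝ → ℂ, IsTestApprox g f ∧ ∀ n, prim (g n) 1 = 0 := by
  obtain ⟨g, hg⟩ := hf.exists_isTestApprox
  obtain ⟨η, hη, hη1⟩ := exists_isTest_prim_eq_one
  obtain ⟨C, hC⟩ := hg.exists_bound
  obtain ⟨D, hD⟩ := hη.bddMeasurable.exists_bound
  have hmean := hg.tendsto_prim (Set.right_mem_Icc.mpr zero_le_one)
  rw [h0] at hmean
  have hbound (n : ℕ) : ‖prim (g n) 1‖ ≤ C := by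
    simpa using (hg.isTest n).bddMeasurable.norm_prim_sub_prim_le (hC n) 0 1
  refine ⟨fun n x => g n x - prim (g n) 1 * η x,
    ⟨fun n => (hg.isTest n).sub (hη.const_mul _), ⟨C + C * D, fun n x => ?_⟩, ?_⟩, fun n => ?_⟩
  · refine norm_sub_le_of_le (hC n x) ?_
    rw [norm_mul]
    exact mul_le_mul (hbound n) (hD x) (norm_nonneg _) ((norm_nonneg _).trans (hbound n))
  · filter_upwards [hg.tendsto] with x hx
    simpa using hx.sub (hmean.mul_const (η x))
  · rw [prim, intervalIntegral.integral_sub ((hg.isTest n).bddMeasurable.intervalIntegrable _ _)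
      ((hη.const_mul _).bddMeasurable.intervalIntegrable _ _),
      intervalIntegral.integral_const_mul, ← prim, ← prim, hη1, mul_one, sub_self]

lemma IsTestApprox.prim (hg : IsTestApprox g f) (h0 : ∀ n, prim (g n) 1 = 0) :
    IsTestApprox (fun n => prim (g n)) (prim f) := by
  obtain ⟨C, hC⟩ := hg.exists_bound
  have hC0 : 0 ≤ C := (norm_nonneg _).trans (hC 0 0)
  have htest (n : ℕ) := (hg.isTest n).prim (h0 n)
  refine ⟨htest, ⟨C, fun n x => ?_⟩,
    (ae_restrict_iff' measurableSet_Icc).mpr (.of_forall fun x => hg.tendsto_prim)⟩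
  by_cases hx : x ∈ Set.Icc (0 : ℝ) 1
  · have h := (hg.isTest n).bddMeasurable.norm_prim_sub_prim_le (hC n) 0 x
    rw [prim_zero, sub_zero, sub_zero, abs_of_nonneg hx.1] at h
    exact h.trans (mul_le_of_le_one_right hC0 hx.2)
  · obtain ⟨δ, hδ0, hδ⟩ := (htest n).exists_support_subset
    have hzero : QMC.prim (g n) x = 0 := by
      refine Function.notMem_support.mp fun h => hx ?_
      exact Set.Icc_subset_Icc hδ0.le (by linarith) (hδ h)
    rwa [hzero, norm_zero]

end IsTestApprox

/-! ### Integration by parts against tensor products -/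

section Pairing
variable {s : ℕ}

lemma cube_eq_pi (s : ℕ) : cube s = Set.univ.pi fun _ => Set.Icc (0 : ℝ) 1 :=
  (Set.pi_univ_Icc 0 1).symm

lemma restrict_cube (s : ℕ) : (volume : Measure (Fin s → ℝ)).restrict (cube s)
    = Measure.pi fun _ => volume.restrict (Set.Icc (0 : ℝ) 1) := by
  rw [cube_eq_pi, volume_pi, Measure.restrict_pi_pi]

instance : IsProbabilityMeasure ((volume : Measure ℝ).restrict (Set.Icc (0 : ℝ) 1)) :=
  ⟨by simp⟩

instance (s : ℕ) : IsProbabilityMeasure ((volume : Measure (Fin s → ℝ)).restrict (cube s)) := by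
  rw [restrict_cube]
  infer_instance

/-- The tensor product of functions of one variable. -/
def tensor (h : Fin s → ℝ → ℂ) (y : Fin s → ℝ) : ℂ := ∏ i, h i (y i)

/-- Integration over the unit cube against a tensor product. -/
def pairing (G : (Fin s → ℝ) → ℝ) (h : Fin s → ℝ → ℂ) : ℂ :=
  ∫ y in cube s, (G y : ℂ) * tensor h y

variable {G : (Fin s → ℝ) → ℝ} {h : Fin s → ℝ → ℂ}

lemma measurable_tensor (hh : ∀ i, Measurable (h i)) : Measurable (tensor h) :=
  Finset.measurable_prod _ fun i _ => (hh i).comp (measurable_pi_apply i)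

lemma norm_tensor_le {C : Fin s → ℝ} (hC : ∀ i x, ‖h i x‖ ≤ C i) (y : Fin s → ℝ) :
    ‖tensor h y‖ ≤ ∏ i, C i := by
  rw [tensor, norm_prod]
  exact Finset.prod_le_prod (fun i _ => norm_nonneg _) fun i _ => hC i _

lemma tensor_update (h : Fin s → ℝ → ℂ) (j : Fin s) (f : ℝ → ℂ) (y : Fin s → ℝ) :
    tensor (Function.update h j f) y = f (y j) * ∏ i ∈ Finset.univ.erase j, h i (y i) := by
  rw [tensor, ← Finset.mul_prod_erase _ _ (Finset.mem_univ j), Function.update_self]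
  congr 1
  refine Finset.prod_congr rfl fun i hi => ?_
  rw [Function.update_of_ne (Finset.ne_of_mem_erase hi)]

lemma integrable_mul_tensor (hG : IntegrableOn G (cube s)) (hh : ∀ i, BddMeasurable (h i)) :
    IntegrableOn (fun y => (G y : ℂ) * tensor h y) (cube s) := by
  choose C hC using fun i => (hh i).exists_bound
  exact Integrable.mul_bdd (c := ∏ i, C i) hG.ofReal
    (measurable_tensor fun i => (hh i).measurable).aestronglyMeasurable
    (.of_forall (norm_tensor_le hC))

lemma pairing_update_sub_const (hG : IntegrableOn G (cube s)) (hh : ∀ i, BddMeasurable (h i))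
    (j : Fin s) (c : ℂ) :
    pairing G (Function.update h j fun x => h j x - c)
      = pairing G h - c * pairing G (Function.update h j fun _ => 1) := by
  have hone : ∀ i, BddMeasurable (Function.update h j (fun _ => 1) i) :=
    (Function.forall_update_iff h fun _ => BddMeasurable).mpr
      ⟨bddMeasurable_const 1, fun i _ => hh i⟩
  rw [pairing, pairing, pairing, ← integral_const_mul, ← integral_sub
    (integrable_mul_tensor hG hh) ((integrable_mul_tensor hG hone).const_mul c)]
  congr 1 with y
  conv_rhs => rw [← Function.update_eq_self j h]
  rw [Function.update_idem, tensor_update, tensor_update, tensor_update]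
  ring

lemma tendsto_pairing (hG : IntegrableOn G (cube s)) {g : Fin s → ℕ → ℝ → ℂ}
    (hg : ∀ i, IsTestApprox (g i) (h i)) :
    Filter.Tendsto (fun n => pairing G fun i => g i n) Filter.atTop (nhds (pairing G h)) := by
  choose C hC using fun i => (hg i).exists_bound
  have hm (n : ℕ) : Measurable (tensor fun i => g i n) :=
    measurable_tensor fun i => ((hg i).isTest n).bddMeasurable.measurable
  refine tendsto_integral_of_dominated_convergence (fun y => ‖G y‖ * ∏ i, C i)
    (fun n => hG.ofReal.aestronglyMeasurable.mul (hm n).aestronglyMeasurable)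
    (hG.norm.mul_const _) (fun n => .of_forall fun y => ?_) ?_
  · rw [norm_mul, Complex.norm_real]
    gcongr
    exact norm_tensor_le (fun i => hC i n) y
  · rw [restrict_cube]
    have hae := Filter.eventually_all.2 fun i => (Measure.tendsto_eval_ae_ae (i := i)
      (μ := fun _ : Fin s => (volume : Measure ℝ).restrict (Set.Icc (0 : ℝ) 1))).eventually
        (hg i).tendsto
    filter_upwards [hae] with y hy
    exact (tendsto_finsetProd _ fun i _ => hy i).const_mul _

variable {j : Fin s} {f g : (Fin s → ℝ) → ℝ}

lemma IsWeakPartial.integral_mul_fderiv_complex (h : IsWeakPartial j f g)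
    (hf : IntegrableOn f (cube s)) (hg : IntegrableOn g (cube s))
    {φ : (Fin s → ℝ) → ℂ} (hφ : ContDiff ℝ ∞ φ) (hc : HasCompactSupport φ)
    (hs : tsupport φ ⊆ Set.univ.pi fun _ => Set.Ioo (0 : ℝ) 1) :
    ∫ x in cube s, (f x : ℂ) * fderiv ℝ φ x (Pi.single j 1)
      = - ∫ x in cube s, (g x : ℂ) * φ x := by
  have hcont : Continuous fun x => fderiv ℝ φ x (Pi.single j 1) :=
    (hφ.continuous_fderiv (by simp)).clm_apply continuous_const
  obtain ⟨A, hA⟩ := hcont.bounded_above_of_compact_support (hc.fderiv_apply ℝ _)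
  obtain ⟨B, hB⟩ := hφ.continuous.bounded_above_of_compact_support hc
  have hi1 : IntegrableOn (fun x => (f x : ℂ) * fderiv ℝ φ x (Pi.single j 1)) (cube s) :=
    Integrable.mul_bdd (c := A) hf.ofReal hcont.aestronglyMeasurable (.of_forall hA)
  have hi2 : IntegrableOn (fun x => (g x : ℂ) * φ x) (cube s) :=
    Integrable.mul_bdd (c := B) hg.ofReal hφ.continuous.aestronglyMeasurable (.of_forall hB)
  have hreal : ∀ L : ℂ →L[ℝ] ℝ, L (∫ x in cube s, (f x : ℂ) * fderiv ℝ φ x (Pi.single j 1))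
      = L (- ∫ x in cube s, (g x : ℂ) * φ x) := by
    intro L
    have hL (t : ℝ) (z : ℂ) : L ((t : ℂ) * z) = t * L z := by
      rw [← Complex.real_smul, map_smul, smul_eq_mul]
    have hfderiv (x : Fin s → ℝ) : fderiv ℝ (L ∘ φ) x (Pi.single j 1)
        = L (fderiv ℝ φ x (Pi.single j 1)) := by
      rw [fderiv_comp _ L.differentiableAt (hφ.differentiable (by simp) x), L.fderiv]
      rfl
    have hLφ := h (L ∘ φ) (L.contDiff.comp hφ) (hc.comp_left (map_zero L))
      ((closure_mono (Function.support_comp_subset (map_zero L) φ)).trans hs)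
    rw [map_neg, ← L.integral_comp_comm hi1, ← L.integral_comp_comm hi2]
    simpa only [hL, hfderiv, Function.comp_apply] using hLφ
  exact Complex.ext (hreal Complex.reCLM) (hreal Complex.imCLM)

lemma tsupport_tensor_subset (hh : ∀ i, IsTest (h i)) :
    HasCompactSupport (tensor h) ∧
      tsupport (tensor h) ⊆ Set.univ.pi fun _ => Set.Ioo (0 : ℝ) 1 := by
  choose δ hδ0 hδ using fun i => (hh i).exists_support_subset
  have hK : IsCompact (Set.univ.pi fun i => Set.Icc (δ i) (1 - δ i)) :=
    isCompact_univ_pi fun i => isCompact_Icc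
  have hsupp : Function.support (tensor h) ⊆ Set.univ.pi fun i => Set.Icc (δ i) (1 - δ i) :=
    fun y hy i _ => hδ i fun h0 => hy (Finset.prod_eq_zero (Finset.mem_univ i) h0)
  exact ⟨.of_support_subset_isCompact hK hsupp, (closure_minimal hsupp hK.isClosed).trans
    (Set.pi_mono fun i _ => Set.Icc_subset_Ioo (hδ0 i) (by linarith [hδ0 i]))⟩

lemma fderiv_tensor_single (hh : ∀ i, ContDiff ℝ ∞ (h i)) (j : Fin s) (y : Fin s → ℝ) :
    fderiv ℝ (tensor h) y (Pi.single j 1) = tensor (Function.update h j (deriv (h j))) y := by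
  have hsm : ContDiff ℝ ∞ (tensor h) := contDiff_prod fun i _ => (hh i).comp (contDiff_apply ℝ ℝ i)
  have hline (t : ℝ) : tensor h (y + t • Pi.single j 1)
      = h j (y j + t) * ∏ i ∈ Finset.univ.erase j, h i (y i) := by
    rw [tensor, ← Finset.mul_prod_erase _ _ (Finset.mem_univ j)]
    congr 1
    · simp
    · refine Finset.prod_congr rfl fun i hi => ?_
      simp [Finset.ne_of_mem_erase hi]
  rw [← (hsm.differentiable (by simp) y).lineDeriv_eq_fderiv, lineDeriv, tensor_update,
    funext hline, deriv_mul_const_field, deriv_comp_const_add, add_zero]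

lemma IsWeakPartial.pairing_update_deriv (hw : IsWeakPartial j f g)
    (hf : IntegrableOn f (cube s)) (hg : IntegrableOn g (cube s)) (hh : ∀ i, IsTest (h i)) :
    pairing f (Function.update h j (deriv (h j))) = - pairing g h := by
  obtain ⟨hc, hs⟩ := tsupport_tensor_subset hh
  have hsm : ContDiff ℝ ∞ (tensor h) :=
    contDiff_prod fun i _ => (hh i).contDiff.comp (contDiff_apply ℝ ℝ i)
  simp only [pairing, ← hw.integral_mul_fderiv_complex hf hg hsm hc hs,
    fderiv_tensor_single fun i => (hh i).contDiff]

/-- The mean of `w` has to vanish for `prim w` to be approximable by test functions, i.e. for the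
boundary terms to disappear. -/
lemma IsWeakPartial.pairing_update_prim (hw : IsWeakPartial j f g)
    (hf : IntegrableOn f (cube s)) (hg : IntegrableOn g (cube s))
    (hh : ∀ i, BddMeasurable (h i)) {w : ℝ → ℂ} (hwm : BddMeasurable w) (h0 : prim w 1 = 0) :
    pairing f (Function.update h j w) = - pairing g (Function.update h j (prim w)) := by
  choose θ hθ using fun i => (hh i).exists_isTestApprox
  obtain ⟨ξ, hξ, hξ0⟩ := hwm.exists_isTestApprox_mean_zero h0
  have happrox : ∀ {a : ℕ → ℝ → ℂ} {a' : ℝ → ℂ}, IsTestApprox a a' →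
      ∀ i, IsTestApprox (Function.update θ j a i) (Function.update h j a' i) := fun ha i => by
    rcases eq_or_ne i j with rfl | hij
    · simpa using ha
    · simpa [hij] using hθ i
  have hlimf := tendsto_pairing hf (happrox hξ)
  have hlimg := tendsto_pairing hg (happrox (hξ.prim hξ0))
  refine tendsto_nhds_unique hlimf (hlimg.neg.congr fun n => ?_)
  rw [← hw.pairing_update_deriv hf hg fun i => (happrox (hξ.prim hξ0) i).isTest n]
  congr 1 with i : 1
  rcases eq_or_ne i j with rfl | hij
  · simp [deriv_prim ((hξ.isTest n).contDiff.continuous)]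
  · simp [hij]

end Pairing

/-! ### Integrating out coordinates -/

section IntegrateOut
variable {s : ℕ} {G : (Fin s → ℝ) → ℝ} {h : Fin s → ℝ → ℂ} (v : Finset (Fin s))

lemma measurable_piecewise_prod :
    Measurable fun p : (Fin s → ℝ) × (Fin s → ℝ) => v.piecewise p.1 p.2 := by
  refine measurable_pi_lambda _ fun i => ?_
  by_cases hi : i ∈ v
  · simpa [Finset.piecewise, hi] using measurable_fst.eval (a := i)
  · simpa [Finset.piecewise, hi] using measurable_snd.eval (a := i)

lemma measurePreserving_piecewise :
    MeasurePreserving (fun p : (Fin s → ℝ) × (Fin s → ℝ) => v.piecewise p.1 p.2)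
      ((volume.restrict (cube s)).prod (volume.restrict (cube s))) (volume.restrict (cube s)) := by
  refine ⟨measurable_piecewise_prod v, ?_⟩
  rw [restrict_cube]
  refine (Measure.pi_eq fun S hS => ?_).symm
  have hpre : (fun p : (Fin s → ℝ) × (Fin s → ℝ) => v.piecewise p.1 p.2) ⁻¹' Set.univ.pi S
      = (Set.univ.pi fun i => if i ∈ v then S i else Set.univ) ×ˢ
        (Set.univ.pi fun i => if i ∈ v then Set.univ else S i) := by
    ext p
    simp only [Set.mem_preimage, Set.mem_pi, Set.mem_univ, forall_true_left, Set.mem_prod,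
      ← forall_and]
    refine forall_congr' fun i => ?_
    by_cases hi : i ∈ v <;> simp [hi]
  rw [Measure.map_apply (measurable_piecewise_prod v) (MeasurableSet.univ_pi hS), hpre,
    Measure.prod_prod, Measure.pi_pi, Measure.pi_pi, ← Finset.prod_mul_distrib]
  refine Finset.prod_congr rfl fun i _ => ?_
  by_cases hi : i ∈ v <;> simp [hi]

lemma pairing_eq_pairing_integrateOut (hG : IntegrableOn G (cube s))
    (hh : ∀ i, BddMeasurable (h i)) (h1 : ∀ i ∉ v, h i = fun _ => 1) :
    pairing G h = pairing (integrateOut v G) h := by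
  have htensor (y z : Fin s → ℝ) : tensor h (v.piecewise y z) = tensor h y := by
    refine Finset.prod_congr rfl fun i _ => ?_
    by_cases hi : i ∈ v
    · simp [hi]
    · simp [h1 i hi]
  have hp := measurePreserving_piecewise v
  have hi := integrable_mul_tensor hG hh
  calc pairing G h
      = ∫ p, (G (v.piecewise p.1 p.2) : ℂ) * tensor h (v.piecewise p.1 p.2)
          ∂((volume.restrict (cube s)).prod (volume.restrict (cube s))) := by
        have hmap := integral_map hp.measurable.aemeasurable
          (hp.map_eq.symm ▸ hi.aestronglyMeasurable)
        rwa [hp.map_eq] at hmap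
    _ = ∫ y in cube s, ∫ z in cube s, (G (v.piecewise y z) : ℂ) * tensor h y := by
        simpa only [Function.comp_apply, htensor] using
          integral_prod _ (hp.integrable_comp_of_integrable hi)
    _ = pairing (integrateOut v G) h := by
        simp only [integral_mul_const, integral_complex_ofReal, pairing, integrateOut]

lemma integrable_integrateOut (hG : IntegrableOn G (cube s)) :
    IntegrableOn (integrateOut v G) (cube s) :=
  ((measurePreserving_piecewise v).integrable_comp_of_integrable hG).integral_prod_left

lemma enorm_pairing_le (hG : IntegrableOn G (cube s)) (hh : ∀ i, BddMeasurable (h i))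
    (h1 : ∀ i ∉ v, h i = fun _ => 1) :
    ‖pairing G h‖ₑ
      ≤ (∏ i ∈ v, ⨆ x, ‖h i x‖ₑ) * eLpNorm (integrateOut v G) 1 (volume.restrict (cube s)) := by
  have htensor (y : Fin s → ℝ) : ‖tensor h y‖ₑ ≤ ∏ i ∈ v, ⨆ x, ‖h i x‖ₑ := by
    rw [tensor, enorm_eq_nnnorm, nnnorm_prod, ENNReal.ofNNReal_finsetProd,
      ← Finset.prod_subset (Finset.subset_univ v)]
    · gcongr with i
      exact le_iSup (fun x => ‖h i x‖ₑ) (y i)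
    · intro i _ hi
      simp [h1 i hi]
  rw [pairing_eq_pairing_integrateOut v hG hh h1, eLpNorm_one_eq_lintegral_enorm,
    ← lintegral_const_mul'' _ (integrable_integrateOut v hG).aestronglyMeasurable.enorm]
  refine (enorm_integral_le_lintegral_enorm _).trans (lintegral_mono fun y => ?_)
  have hreal : ‖((integrateOut v G y : ℝ) : ℂ)‖ₑ = ‖integrateOut v G y‖ₑ := by
    simp only [enorm_eq_nnnorm, Complex.nnnorm_real]
  rw [enorm_mul, mul_comm, hreal]
  gcongr
  exact htensor y

end IntegrateOut

/-! ### Pairings as Walsh coefficients -/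

/-- The situation reached while `∫ F · ∏ h i` over the unit cube is integrated by parts: the
derivative `∂^ν F` is paired with the tensor product of the `h i`. Only the factors in `R` are
still different from `1`, and a coordinate in `u` that has not been integrated yet has a factor of
mean zero, so that the first integration does not produce a term without derivative. -/
structure IsPartsStage {s : ℕ} (α : ℕ) (u R : Finset (Fin s)) (ν : Fin s → ℕ)
    (h : Fin s → ℝ → ℂ) : Prop where
  le : ∀ i, ν i ≤ α
  eq_zero : ∀ i ∉ u, ν i = 0
  subset : R ⊆ u
  eq_one : ∀ i ∉ R, h i = fun _ => 1
  mean_zero : ∀ i ∈ u, ν i = 0 → i ∈ R ∧ prim (h i) 1 = 0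
  bddMeasurable : ∀ i, BddMeasurable (h i)
  periodic : ∀ i, Function.Periodic (h i) 1

namespace IsPartsStage
variable {s α : ℕ} {u R : Finset (Fin s)} {ν : Fin s → ℕ} {h : Fin s → ℝ → ℂ} {j : Fin s}

lemma erase (hs : IsPartsStage α u R ν h) (hν : ν j ≠ 0) :
    IsPartsStage α u (R.erase j) ν (Function.update h j fun _ => 1) where
  le := hs.le
  eq_zero := hs.eq_zero
  subset := (R.erase_subset j).trans hs.subset
  eq_one i hi := by
    rcases eq_or_ne i j with rfl | hij
    · simp
    · rw [Function.update_of_ne hij]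
      exact hs.eq_one i fun hR => hi (Finset.mem_erase.mpr ⟨hij, hR⟩)
  mean_zero i hi h0 := by
    have hij : i ≠ j := by
      rintro rfl
      exact hν h0
    rw [Function.update_of_ne hij]
    exact ⟨Finset.mem_erase.mpr ⟨hij, (hs.mean_zero i hi h0).1⟩, (hs.mean_zero i hi h0).2⟩
  bddMeasurable := (Function.forall_update_iff h fun _ => BddMeasurable).mpr
    ⟨bddMeasurable_const 1, fun i _ => hs.bddMeasurable i⟩
  periodic := (Function.forall_update_iff h fun _ f => Function.Periodic f 1).mpr
    ⟨fun _ => rfl, fun i _ => hs.periodic i⟩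

lemma bddMeasurable_sub_mean (hs : IsPartsStage α u R ν h) (j : Fin s) :
    BddMeasurable fun x => h j x - prim (h j) 1 :=
  (hs.bddMeasurable j).sub_const _

lemma periodic_sub_mean (hs : IsPartsStage α u R ν h) (j : Fin s) :
    Function.Periodic (fun x => h j x - prim (h j) 1) 1 :=
  fun x => by simp only [hs.periodic j x]

lemma prim_sub_mean (hs : IsPartsStage α u R ν h) (j : Fin s) :
    prim (fun x => h j x - prim (h j) 1) 1 = 0 := by
  simp [(hs.bddMeasurable j).prim_sub_const]

lemma integrate (hs : IsPartsStage α u R ν h) (hj : j ∈ R) (hν : ν j < α) :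
    IsPartsStage α u R (ν + Pi.single j 1)
      (Function.update h j (prim fun x => h j x - prim (h j) 1)) where
  le i := by
    rcases eq_or_ne i j with rfl | hij
    · simpa using hν
    · simpa [hij] using hs.le i
  eq_zero i hi := by
    have hij : i ≠ j := fun h => hi (h ▸ hs.subset hj)
    simpa [hij] using hs.eq_zero i hi
  subset := hs.subset
  eq_one i hi := by
    have hij : i ≠ j := fun h => hi (h ▸ hj)
    rw [Function.update_of_ne hij]
    exact hs.eq_one i hi
  mean_zero i hi h0 := by
    have hij : i ≠ j := by
      rintro rfl
      simp at h0
    rw [Function.update_of_ne hij]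
    exact hs.mean_zero i hi (by simpa [hij] using h0)
  bddMeasurable := (Function.forall_update_iff h fun _ => BddMeasurable).mpr
    ⟨(hs.bddMeasurable_sub_mean j).prim_of_periodic one_pos (hs.periodic_sub_mean j)
      (hs.prim_sub_mean j), fun i _ => hs.bddMeasurable i⟩
  periodic := (Function.forall_update_iff h fun _ f => Function.Periodic f 1).mpr
    ⟨(hs.bddMeasurable_sub_mean j).periodic_prim (hs.periodic_sub_mean j) (hs.prim_sub_mean j),
      fun i _ => hs.periodic i⟩

lemma exists_mem_derivIndices (hs : IsPartsStage α u R ν h) (hR : ∀ i ∈ R, ν i = α) :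
    ∃ τ, ⟨R, τ⟩ ∈ derivIndices α u ∧ multiIndex α R τ = ν := by
  refine ⟨fun i => if i ∈ R then 0 else ν i, ?_, ?_⟩
  · simp only [derivIndices, Finset.mem_sigma, Finset.mem_powerset, Fintype.mem_piFinset]
    refine ⟨hs.subset, fun i => ?_⟩
    by_cases hi : i ∈ R
    · simp [hi]
    by_cases hu : i ∈ u
    · have h1 : ν i ≠ 0 := fun h0 => hi (hs.mean_zero i hu h0).1
      simp [hi, hu, hs.le i, Nat.one_le_iff_ne_zero, h1]
    · simp [hi, hu, hs.eq_zero i hu]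
  · funext i
    by_cases hi : i ∈ R
    · simp [multiIndex, hi, hR i hi]
    · simp [multiIndex, hi]

variable {F : (Fin s → ℝ) → ℝ} {D : (Fin s → ℕ) → (Fin s → ℝ) → ℝ}

lemma pairing_eq (hs : IsPartsStage α u R ν h) (hD : IsMixedDerivFamily α F D) (hν : ν j < α) :
    pairing (D ν) h = prim (h j) 1 * pairing (D ν) (Function.update h j fun _ => 1)
      - pairing (D (ν + Pi.single j 1))
          (Function.update h j (prim fun x => h j x - prim (h j) 1)) := by
  have hle : ∀ i, (ν + Pi.single j 1 : Fin s → ℕ) i ≤ α := fun i => by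
    rcases eq_or_ne i j with rfl | hij
    · simpa using hν
    · simpa [hij] using hs.le i
  have hparts := (hD.weakPartial ν hs.le j hν).pairing_update_prim (hD.integrable ν hs.le)
    (hD.integrable _ hle) hs.bddMeasurable (hs.bddMeasurable_sub_mean j) (hs.prim_sub_mean j)
  rw [pairing_update_sub_const (hD.integrable ν hs.le) hs.bddMeasurable] at hparts
  linear_combination hparts

lemma enorm_pairing_le_of_step (hs : IsPartsStage α u R ν h) (hD : IsMixedDerivFamily α F D)
    (hj : j ∈ R) {n : ℕ} (hn : α - ν j = n + 1) {Y : ℝ≥0∞}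
    (herase : ν j ≠ 0 → ‖pairing (D ν) (Function.update h j fun _ => 1)‖ₑ ≤ Y)
    (hint : ‖pairing (D (ν + Pi.single j 1))
        (Function.update h j (prim fun x => h j x - prim (h j) 1))‖ₑ
      ≤ primNorm n (prim fun x => h j x - prim (h j) 1) * Y) :
    ‖pairing (D ν) h‖ₑ ≤ primNorm (n + 1) (h j) * Y := by
  have hmean : ‖prim (h j) 1 * pairing (D ν) (Function.update h j fun _ => 1)‖ₑ
      ≤ ‖prim (h j) 1‖ₑ * Y := by
    rw [enorm_mul]
    rcases eq_or_ne (prim (h j) 1) 0 with h0 | h0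
    · simp [h0]
    · gcongr
      exact herase fun hν => h0 (hs.mean_zero j (hs.subset hj) hν).2
  rw [hs.pairing_eq hD (by omega : ν j < α), primNorm, add_mul]
  exact enorm_sub_le.trans (add_le_add hmean hint)

theorem enorm_pairing_le (hs : IsPartsStage α u R ν h) (hD : IsMixedDerivFamily α F D)
    {X : ℝ≥0∞} (hX : ∀ p ∈ derivIndices α u,
      eLpNorm (integrateOut p.1 (D (multiIndex α p.1 p.2))) 1 (volume.restrict (cube s)) ≤ X) :
    ‖pairing (D ν) h‖ₑ ≤ (∏ i ∈ R, primNorm (α - ν i) (h i)) * X := by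
  induction hk : ∑ i ∈ R, (α - ν i) using Nat.strong_induction_on generalizing R ν h with
  | _ k ih =>
  subst hk
  by_cases hR : ∀ i ∈ R, ν i = α
  · obtain ⟨τ, hτ, rfl⟩ := hs.exists_mem_derivIndices hR
    refine (QMC.enorm_pairing_le R (hD.integrable _ hs.le) hs.bddMeasurable hs.eq_one).trans ?_
    refine mul_le_mul' (Finset.prod_le_prod' fun i hi => ?_) (hX ⟨R, τ⟩ hτ)
    simp [hR i hi, primNorm]
  push Not at hR
  obtain ⟨j, hj, hne⟩ := hR
  have hν : ν j < α := (hs.le j).lt_of_ne hne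
  obtain ⟨n, hn⟩ : ∃ n, α - ν j = n + 1 := Nat.exists_eq_succ_of_ne_zero (by omega)
  have hrest : ∀ c (f : ℝ → ℂ), ∏ i ∈ R.erase j, primNorm (α - (ν + Pi.single j c : Fin s → ℕ) i)
      (Function.update h j f i) = ∏ i ∈ R.erase j, primNorm (α - ν i) (h i) := fun c f =>
    Finset.prod_congr rfl fun i hi => by simp [Finset.ne_of_mem_erase hi]
  rw [← Finset.mul_prod_erase _ _ hj, hn, mul_assoc]
  refine hs.enorm_pairing_le_of_step hD hj hn (fun hν0 => ?_) ?_
  · rw [← hrest 0 fun _ => 1]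
    simp only [Pi.single_zero, add_zero]
    refine ih _ ?_ (hs.erase hν0) rfl
    rw [← Finset.add_sum_erase _ _ hj]
    omega
  · have hn' : α - (ν + Pi.single j 1 : Fin s → ℕ) j = n := by
      simp only [Pi.add_apply, Pi.single_eq_same]
      omega
    refine (ih _ ?_ (hs.integrate hj hν) rfl).trans_eq ?_
    · refine Finset.sum_lt_sum (fun i _ => Nat.sub_le_sub_left (by simp) _) ⟨j, hj, ?_⟩
      omega
    · rw [← Finset.mul_prod_erase _ _ hj, hrest, hn', Function.update_self, mul_assoc]

end IsPartsStage

/-! ### Walsh partial sums -/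

section Kernel
variable {b : ℕ} [NeZero b]

omit [NeZero b] in
lemma sum_range_pow_succ {M : Type*} [AddCommMonoid M] (f : ℕ → M) (l : ℕ) :
    ∑ k ∈ Finset.range (b ^ (l + 1)), f k
      = ∑ κ ∈ Finset.range b, ∑ K ∈ Finset.range (b ^ l), f (κ * b ^ l + K) := by
  rw [pow_succ', Finset.sum_range, ← finProdFinEquiv.sum_comp, Fintype.sum_prod_type]
  simp [Finset.sum_range, add_comm, mul_comm]

lemma sum_range_natCast_zmod {M : Type*} [AddCommMonoid M] (f : ZMod b → M) :
    ∑ c ∈ Finset.range b, f c = ∑ z, f z :=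
  Finset.sum_nbij' (fun c => c) ZMod.val (by simp) (by simp [ZMod.val_lt])
    (fun c hc => ZMod.val_cast_of_lt (Finset.mem_range.mp hc)) (by simp) (by simp)

lemma sum_stdAddChar_natCast_mul (z : ZMod b) :
    ∑ c ∈ Finset.range b, stdAddChar ((c : ZMod b) * z) = if z = 0 then (b : ℂ) else 0 := by
  rw [sum_range_natCast_zmod fun c => stdAddChar (c * z),
    AddChar.sum_mulShift z (ZMod.isPrimitive_stdAddChar b), ZMod.card]
  split_ifs <;> simp

/-- The reproducing kernel of the Walsh functions with index less than `b ^ l`. -/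
def walshKernel (b : ℕ) [NeZero b] (l : ℕ) (x y : ℝ) : ℂ :=
  ∑ k ∈ Finset.range (b ^ l), walsh b k x * (starRingEnd ℂ) (walsh b k y)

lemma walshKernel_succ (hb : 2 ≤ b) (l : ℕ) (x y : ℝ) :
    walshKernel b (l + 1) x y
      = (if realDigit b x l = realDigit b y l then (b : ℂ) else 0) * walshKernel b l x y := by
  simp only [← sub_eq_zero (a := realDigit b x l)]
  rw [← sum_stdAddChar_natCast_mul, walshKernel, sum_range_pow_succ, walshKernel,
    Finset.sum_mul_sum]
  refine Finset.sum_congr rfl fun κ hκ => Finset.sum_congr rfl fun K hK => ?_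
  rw [Finset.mem_range] at hκ hK
  rw [walsh_leading_add hb hκ hK, walsh_leading_add hb hκ hK, map_mul (starRingEnd ℂ), mul_sub,
    sub_eq_add_neg, AddChar.map_add_eq_mul, AddChar.map_neg_eq_conj]
  ring

lemma floor_mul_pow_eq_iff (x y : ℝ) (l : ℕ) :
    ⌊x * (b : ℝ) ^ (l + 1)⌋ = ⌊y * (b : ℝ) ^ (l + 1)⌋ ↔
      realDigit b x l = realDigit b y l ∧ ⌊x * (b : ℝ) ^ l⌋ = ⌊y * (b : ℝ) ^ l⌋ := by
  have hfloor (x : ℝ) : ⌊x * (b : ℝ) ^ l⌋ = ⌊x * (b : ℝ) ^ (l + 1)⌋ / (b : ℤ) := by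
    have hb0 : (b : ℝ) ≠ 0 := by exact_mod_cast NeZero.ne b
    rw [← Int.floor_div_natCast, pow_succ]
    field_simp
  rw [hfloor x, hfloor y, realDigit, realDigit, ZMod.intCast_eq_intCast_iff']
  refine ⟨fun h => by simp [h], fun ⟨hmod, hdiv⟩ => ?_⟩
  rw [← Int.mul_ediv_add_emod ⌊x * (b : ℝ) ^ (l + 1)⌋ b, hmod, hdiv, Int.mul_ediv_add_emod]

lemma walshKernel_eq (hb : 2 ≤ b) (l : ℕ) {x y : ℝ} (hx : x ∈ Set.Ico (0 : ℝ) 1)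
    (hy : y ∈ Set.Ico (0 : ℝ) 1) :
    walshKernel b l x y
      = if ⌊x * (b : ℝ) ^ l⌋ = ⌊y * (b : ℝ) ^ l⌋ then (b : ℂ) ^ l else 0 := by
  induction l with
  | zero => simp [walshKernel, Int.floor_eq_zero_iff.mpr hx, Int.floor_eq_zero_iff.mpr hy]
  | succ l ih =>
    rw [walshKernel_succ hb, ih, ite_zero_mul_ite_zero, ← pow_succ']
    exact if_congr (floor_mul_pow_eq_iff x y l).symm rfl rfl

lemma abs_sub_le_of_walshKernel_ne_zero (hb : 2 ≤ b) {l : ℕ} {x y : ℝ}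
    (hx : x ∈ Set.Ico (0 : ℝ) 1) (hy : y ∈ Set.Ico (0 : ℝ) 1) (h : walshKernel b l x y ≠ 0) :
    |x - y| ≤ ((b : ℝ) ^ l)⁻¹ := by
  have hpow := pow_natCast_pos (b := b) l
  have hfloor : ⌊x * (b : ℝ) ^ l⌋ = ⌊y * (b : ℝ) ^ l⌋ := by
    by_contra hne
    exact h (by rw [walshKernel_eq hb l hx hy, if_neg hne])
  have habs := Int.abs_sub_lt_one_of_floor_eq_floor hfloor
  rw [← sub_mul, abs_mul, abs_of_pos hpow, ← lt_div_iff₀ hpow, one_div] at habs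
  exact habs.le

lemma bddMeasurable_walshKernel (hb : 2 ≤ b) (l : ℕ) (y : ℝ) :
    BddMeasurable fun x => walshKernel b l x y where
  measurable := Finset.measurable_sum _ fun k _ =>
    (bddMeasurable_walsh hb k).measurable.mul_const _
  exists_bound := ⟨∑ _ ∈ Finset.range (b ^ l), 1, fun x => norm_sum_le_of_le _ fun _ _ => by
    simp⟩

lemma integral_walshKernel (hb : 2 ≤ b) (l : ℕ) (y : ℝ) :
    ∫ x in Set.Icc (0 : ℝ) 1, walshKernel b l x y = 1 := by
  have hprim (k : ℕ) : ∫ x in (0 : ℝ)..1, walsh b k x = if k = 0 then 1 else 0 := by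
    split_ifs with hk
    · simp [hk]
    · exact prim_walsh_one hb hk
  rw [integral_Icc_eq_integral_Ioc, ← intervalIntegral.integral_of_le zero_le_one]
  simp only [walshKernel]
  rw [intervalIntegral.integral_finsetSum fun k _ =>
    ((bddMeasurable_walsh hb k).intervalIntegrable _ _).mul_const _]
  simp [intervalIntegral.integral_mul_const, hprim, NeZero.ne b]

lemma ae_Icc_mem_Ico :
    ∀ᵐ x ∂(volume : Measure ℝ).restrict (Set.Icc 0 1), x ∈ Set.Ico (0 : ℝ) 1 := by
  rw [← restrict_Ico_eq_restrict_Icc]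
  exact ae_restrict_mem measurableSet_Ico

lemma integral_norm_walshKernel (hb : 2 ≤ b) (l : ℕ) {y : ℝ} (hy : y ∈ Set.Ico (0 : ℝ) 1) :
    ∫ x in Set.Icc (0 : ℝ) 1, ‖walshKernel b l x y‖ = 1 := by
  have hnorm : ∫ x in Set.Icc (0 : ℝ) 1, ((‖walshKernel b l x y‖ : ℝ) : ℂ) = 1 := by
    rw [← integral_walshKernel hb l y]
    refine integral_congr_ae ?_
    filter_upwards [ae_Icc_mem_Ico] with x hx
    rw [walshKernel_eq hb l hx hy]
    split_ifs <;> simp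
  exact Complex.ofReal_eq_one.mp (integral_ofReal.symm.trans hnorm)

end Kernel

section PartialSum
variable {b s : ℕ} [NeZero b]

/-- The partial sum over the indices `k` with entries below `b ^ l` of the Walsh series of `F`. -/
def walshPartialSum (b : ℕ) [NeZero b] (l : ℕ) (F : (Fin s → ℝ) → ℝ) (y : Fin s → ℝ) : ℂ :=
  ∑ k ∈ Fintype.piFinset fun _ => Finset.range (b ^ l),
    pairing F (walsh b ∘ k) * (starRingEnd ℂ) (tensor (walsh b ∘ k) y)

lemma bddMeasurable_walsh_comp (hb : 2 ≤ b) (k : Fin s → ℕ) (i : Fin s) :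
    BddMeasurable ((walsh b ∘ k) i) :=
  bddMeasurable_walsh hb (k i)

/-- The reproducing kernel centred at `y`, one factor per coordinate. -/
def walshKernelAt (b : ℕ) [NeZero b] (l : ℕ) (y : Fin s → ℝ) (i : Fin s) (x : ℝ) : ℂ :=
  walshKernel b l x (y i)

lemma tensor_walshKernelAt (l : ℕ) (x y : Fin s → ℝ) :
    tensor (walshKernelAt b l y) x = ∑ k ∈ Fintype.piFinset fun _ => Finset.range (b ^ l),
      tensor (walsh b ∘ k) x * (starRingEnd ℂ) (tensor (walsh b ∘ k) y) := by
  simp only [tensor, walshKernelAt, walshKernel]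
  rw [Finset.prod_univ_sum]
  simp only [Finset.prod_mul_distrib, map_prod, Function.comp_apply]

lemma walshPartialSum_eq_pairing (hb : 2 ≤ b) (l : ℕ) {F : (Fin s → ℝ) → ℝ}
    (hF : IntegrableOn F (cube s)) (y : Fin s → ℝ) :
    walshPartialSum b l F y = pairing F (walshKernelAt b l y) := by
  simp only [walshPartialSum, pairing, tensor_walshKernelAt, Finset.mul_sum, ← mul_assoc]
  rw [integral_finsetSum _ fun k _ =>
    Integrable.mul_const (integrable_mul_tensor hF (bddMeasurable_walsh_comp hb k)) _]
  simp only [integral_mul_const]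

lemma integral_tensor_walshKernelAt (hb : 2 ≤ b) (l : ℕ) (y : Fin s → ℝ) :
    ∫ x in cube s, tensor (walshKernelAt b l y) x = 1 := by
  simp only [tensor]
  rw [restrict_cube, integral_fintype_prod_eq_prod (𝕜 := ℂ) (f := walshKernelAt b l y)]
  exact Finset.prod_eq_one fun j _ => integral_walshKernel hb l (y j)

lemma integral_norm_tensor_walshKernelAt (hb : 2 ≤ b) (l : ℕ) {y : Fin s → ℝ}
    (hy : ∀ j, y j ∈ Set.Ico (0 : ℝ) 1) :
    ∫ x in cube s, ‖tensor (walshKernelAt b l y) x‖ = 1 := by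
  simp only [tensor, norm_prod]
  rw [restrict_cube, integral_fintype_prod_eq_prod (𝕜 := ℝ)
    (f := fun j x => ‖walshKernelAt b l y j x‖)]
  exact Finset.prod_eq_one fun j _ => integral_norm_walshKernel hb l (hy j)

lemma ae_cube_mem_Ico (s : ℕ) :
    ∀ᵐ x ∂(volume : Measure (Fin s → ℝ)).restrict (cube s), ∀ j, x j ∈ Set.Ico (0 : ℝ) 1 := by
  rw [restrict_cube]
  exact Filter.eventually_all.2 fun i => (Measure.tendsto_eval_ae_ae (i := i)
    (μ := fun _ : Fin s => (volume : Measure ℝ).restrict (Set.Icc 0 1))).eventually ae_Icc_mem_Ico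

lemma dist_le_of_tensor_walshKernelAt_ne_zero (hb : 2 ≤ b) {l : ℕ} {x y : Fin s → ℝ}
    (hx : ∀ j, x j ∈ Set.Ico (0 : ℝ) 1) (hy : ∀ j, y j ∈ Set.Ico (0 : ℝ) 1)
    (h : tensor (walshKernelAt b l y) x ≠ 0) : dist x y ≤ ((b : ℝ) ^ l)⁻¹ := by
  refine (dist_pi_le_iff (inv_pos.mpr (pow_natCast_pos l)).le).mpr fun j => ?_
  exact abs_sub_le_of_walshKernel_ne_zero hb (hx j) (hy j)
    (Finset.prod_ne_zero_iff.mp h j (Finset.mem_univ j))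

lemma norm_walshPartialSum_sub_le (hb : 2 ≤ b) {F : (Fin s → ℝ) → ℝ}
    (hF : IntegrableOn F (cube s)) {y : Fin s → ℝ} (hy : ∀ j, y j ∈ Set.Ico (0 : ℝ) 1) {l : ℕ}
    {ε : ℝ} (hε : ∀ x ∈ cube s, dist x y ≤ ((b : ℝ) ^ l)⁻¹ → |F x - F y| ≤ ε) :
    ‖walshPartialSum b l F y - F y‖ ≤ ε := by
  have hbdd (i : Fin s) : BddMeasurable (walshKernelAt b l y i) :=
    bddMeasurable_walshKernel hb l (y i)
  have hint : IntegrableOn (tensor (walshKernelAt b l y)) (cube s) := by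
    simpa using integrable_mul_tensor (G := fun _ => (1 : ℝ)) (integrable_const _) hbdd
  have hdiff : walshPartialSum b l F y - F y
      = ∫ x in cube s, ((F x : ℂ) - F y) * tensor (walshKernelAt b l y) x := by
    simp only [sub_mul]
    rw [integral_sub (integrable_mul_tensor hF hbdd) (hint.const_mul _), integral_const_mul,
      integral_tensor_walshKernelAt hb, mul_one, walshPartialSum_eq_pairing hb l hF, pairing]
  have hle : ‖∫ x in cube s, ((F x : ℂ) - F y) * tensor (walshKernelAt b l y) x‖
      ≤ ∫ x in cube s, ε * ‖tensor (walshKernelAt b l y) x‖ := by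
    refine norm_integral_le_of_norm_le (hint.norm.const_mul _) ?_
    filter_upwards [ae_cube_mem_Ico s] with x hx
    rw [norm_mul]
    rcases eq_or_ne (tensor (walshKernelAt b l y) x) 0 with h0 | h0
    · simp [h0]
    · gcongr
      rw [← Complex.ofReal_sub, Complex.norm_real]
      exact hε x ⟨fun j => (hx j).1, fun j => (hx j).2.le⟩
        (dist_le_of_tensor_walshKernelAt_ne_zero hb hx hy h0)
  rwa [integral_const_mul, integral_norm_tensor_walshKernelAt hb l hy, mul_one, ← hdiff] at hle

lemma tendsto_walshPartialSum (hb : 2 ≤ b) {F : (Fin s → ℝ) → ℝ} (hF : ContinuousOn F (cube s))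
    {y : Fin s → ℝ} (hy : ∀ j, y j ∈ Set.Ico (0 : ℝ) 1) :
    Filter.Tendsto (fun l => walshPartialSum b l F y) Filter.atTop (nhds (F y : ℂ)) := by
  have hcube : y ∈ cube s := ⟨fun j => (hy j).1, fun j => (hy j).2.le⟩
  have hmesh : Filter.Tendsto (fun l => ((b : ℝ) ^ l)⁻¹) Filter.atTop (nhds 0) :=
    (tendsto_pow_atTop_atTop_of_one_lt (by exact_mod_cast hb)).inv_tendsto_atTop
  rw [Metric.tendsto_nhds]
  intro ε hε
  obtain ⟨δ, hδ, hFδ⟩ := Metric.continuousOn_iff.mp hF y hcube (ε / 2) (half_pos hε)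
  filter_upwards [hmesh.eventually_lt_const hδ] with l hl
  rw [dist_eq_norm]
  refine lt_of_le_of_lt ?_ (half_lt_self hε)
  exact norm_walshPartialSum_sub_le hb (hF.integrableOn_compact isCompact_Icc) hy
    fun x hx hxy => (hFδ x hx (hxy.trans_lt hl)).le

end PartialSum

/-! ### Digit expansions of real numbers -/

section Expansion
variable {b : ℕ}

/-- A digit sequence is proper if infinitely many of its entries differ from `b - 1`; these are the
sequences that are recovered from the real number they represent. -/
def IsProper (d : ℕ → Fin b) : Prop := ∀ n, ∃ i ≥ n, (d i : ℕ) + 1 < b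

lemma IsProper.tail {d : ℕ → Fin b} (hd : IsProper d) : IsProper fun i => d (i + 1) := fun n => by
  obtain ⟨i, hi, hdi⟩ := hd (n + 1)
  exact ⟨i - 1, by omega, by simpa only [Nat.sub_add_cancel (by omega : 1 ≤ i)] using hdi⟩

lemma ofDigits_mul_base (d : ℕ → Fin b) :
    Real.ofDigits d * b = (d 0 : ℕ) + Real.ofDigits fun i => d (i + 1) := by
  have hb : (b : ℝ) ≠ 0 := by exact_mod_cast (d 0).pos.ne'
  rw [Real.ofDigits_eq_sum_add_ofDigits d 1]
  simp only [Finset.sum_range_one, Real.ofDigitsTerm, zero_add, pow_one]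
  field_simp

lemma ofDigits_lt_one {d : ℕ → Fin b} {i : ℕ} (h : (d i : ℕ) + 1 < b) : Real.ofDigits d < 1 := by
  have hb : (0 : ℝ) < b := by exact_mod_cast (d 0).pos
  rw [← mul_lt_mul_iff_left₀ hb, one_mul, ofDigits_mul_base]
  induction i generalizing d with
  | zero =>
    have hhead : ((d 0 : ℕ) : ℝ) + 1 < b := by exact_mod_cast h
    linarith [Real.ofDigits_le_one fun i => d (i + 1)]
  | succ i ih =>
    have htail := ih (d := fun i => d (i + 1)) h
    rw [← ofDigits_mul_base fun i => d (i + 1), mul_lt_iff_lt_one_left hb] at htail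
    have hhead : ((d 0 : ℕ) : ℝ) + 1 ≤ b := by exact_mod_cast (d 0).isLt
    linarith

lemma IsProper.ofDigits_mem_Ico {d : ℕ → Fin b} (hd : IsProper d) :
    Real.ofDigits d ∈ Set.Ico (0 : ℝ) 1 :=
  have ⟨_, _, hi⟩ := hd 0
  ⟨Real.ofDigits_nonneg d, ofDigits_lt_one hi⟩

lemma IsProper.realDigit_ofDigits {d : ℕ → Fin b} (hd : IsProper d) (i : ℕ) :
    realDigit b (Real.ofDigits d) i = ((d i : ℕ) : ZMod b) := by
  induction i generalizing d with
  | zero =>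
    rw [realDigit, zero_add, pow_one, ofDigits_mul_base, Int.floor_natCast_add,
      Int.floor_eq_zero_iff.mpr hd.tail.ofDigits_mem_Ico]
    simp
  | succ i ih =>
    rw [← ih hd.tail, ← realDigit_natCast_add (d 0 : ℕ) (Real.ofDigits fun i => d (i + 1)),
      ← ofDigits_mul_base, realDigit, realDigit, mul_assoc, ← pow_succ']

variable [NeZero b]

lemma natCast_digits {x : ℝ} (hx : 0 ≤ x) (i : ℕ) :
    ((Real.digits x b i : ℕ) : ZMod b) = realDigit b x i := by
  have h : (0 : ℝ) ≤ x * (b : ℝ) ^ (i + 1) := by positivity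
  rw [Real.digits, realDigit, Fin.val_ofNat, ZMod.natCast_mod, ← Int.natCast_floor_eq_floor h]
  simp

lemma IsProper.digits_ofDigits {d : ℕ → Fin b} (hd : IsProper d) :
    Real.digits (Real.ofDigits d) b = d := funext fun i => Fin.ext <| by
  have h := natCast_digits (Real.ofDigits_nonneg d) (b := b) i
  rwa [hd.realDigit_ofDigits, ZMod.natCast_eq_natCast_iff', Nat.mod_eq_of_lt (Fin.isLt _),
    Nat.mod_eq_of_lt (Fin.isLt _)] at h

lemma isProper_digits (hb : 2 ≤ b) {x : ℝ} (hx : x ∈ Set.Ico (0 : ℝ) 1) :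
    IsProper (Real.digits x b) := by
  intro n
  by_contra! hlast
  have hlast_eq : (fun i => Real.digits x b (i + n)) = fun _ => ⟨b - 1, by omega⟩ := by
    funext i
    have := hlast (i + n) (by omega)
    exact Fin.ext (Nat.eq_sub_of_add_eq (le_antisymm (Real.digits x b (i + n)).isLt this))
  have hpow : (b : ℝ) ^ n ≠ 0 := pow_ne_zero _ (by exact_mod_cast NeZero.ne b)
  have hx_eq : (b : ℝ) ^ n * x = ⌊(b : ℝ) ^ n * x⌋₊ + 1 := by
    nth_rewrite 1 [← Real.ofDigits_digits (by omega : 1 < b) hx,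
      Real.ofDigits_eq_sum_add_ofDigits _ n]
    rw [hlast_eq, Real.ofDigits_const_last_eq_one' (by omega), mul_add,
      Real.ofDigits_digits_sum_eq hx, mul_one, mul_inv_cancel₀ hpow]
  exact (Nat.lt_floor_add_one ((b : ℝ) ^ n * x)).ne hx_eq

end Expansion

/-! ### Walsh functions on shifted digital nets -/

section Net
variable {b : ℕ} [NeZero b] {s α m : ℕ}

/-- The digit sequence of the `j`-th coordinate of the `n`-th point of a digital net. -/
def netDigits (C : Fin s → Matrix (Fin (α * m)) (Fin m) (ZMod b)) (n : ℕ) (j : Fin s) (i : ℕ) :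
    Fin b :=
  if h : i < α * m then ⟨((C j *ᵥ digitVec b m n) ⟨i, h⟩).val, ZMod.val_lt _⟩ else 0

/-- The image of a multi-index under the transposed generating matrices; it vanishes exactly on the
dual net. -/
def dualVec (C : Fin s → Matrix (Fin (α * m)) (Fin m) (ZMod b)) (k : Fin s → ℕ) : Fin m → ZMod b :=
  ∑ j, (C j)ᵀ *ᵥ digitVec b (α * m) (k j)

variable (C : Fin s → Matrix (Fin (α * m)) (Fin m) (ZMod b))

lemma natCast_netDigits (n : ℕ) (j : Fin s) (i : ℕ) :
    ((netDigits C n j i : ℕ) : ZMod b)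
      = if h : i < α * m then (C j *ᵥ digitVec b m n) ⟨i, h⟩ else 0 := by
  rw [netDigits]
  split_ifs <;> simp

lemma digitalNet_eq_ofDigits (n : ℕ) (j : Fin s) :
    digitalNet b α m C n j = Real.ofDigits (netDigits C n j) := by
  rw [Real.ofDigits, tsum_eq_sum (s := Finset.range (α * m)), Finset.sum_range, digitalNet]
  · exact Finset.sum_congr rfl fun i _ => by simp [Real.ofDigitsTerm, netDigits, div_eq_mul_inv]
  · intro i hi
    rw [Finset.mem_range] at hi
    simp [Real.ofDigitsTerm, netDigits, hi]

lemma isProper_netDigits_add (n : ℕ) (j : Fin s) {d : ℕ → Fin b} (hd : IsProper d) :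
    IsProper fun i => netDigits C n j i + d i := fun l => by
  obtain ⟨i, hi, hdi⟩ := hd (max l (α * m))
  refine ⟨i, (le_max_left _ _).trans hi, ?_⟩
  have hzero : netDigits C n j i = 0 := dif_neg (not_lt.mpr ((le_max_right _ _).trans hi))
  simpa only [hzero, zero_add] using hdi

lemma isProper_netDigits (hb : 2 ≤ b) (n : ℕ) (j : Fin s) : IsProper (netDigits C n j) := by
  simpa using isProper_netDigits_add C n j (d := 0) fun i =>
    ⟨i, le_rfl, by simpa [Nat.lt_iff_add_one_le] using hb⟩

lemma digitalShift_zero (hb : 2 ≤ b) (n : ℕ) :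
    digitalShift b (digitalNet b α m C n) 0 = digitalNet b α m C n := by
  funext j
  have hzero (i : ℕ) : Real.digits ((0 : Fin s → ℝ) j) b i = 0 := by simp [Real.digits]
  simp only [digitalShift, hzero, add_zero]
  refine Real.ofDigits_digits (by omega) ?_
  rw [digitalNet_eq_ofDigits]
  exact (isProper_netDigits C hb n j).ofDigits_mem_Ico

section Shift
variable (hb : 2 ≤ b) {σ : Fin s → ℝ} (hσ : ∀ j, σ j ∈ Set.Ico (0 : ℝ) 1) (n : ℕ) (j : Fin s)
include hb

lemma digitalShift_digitalNet (σ : Fin s → ℝ) : digitalShift b (digitalNet b α m C n) σ j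
    = Real.ofDigits fun i => netDigits C n j i + Real.digits (σ j) b i := by
  rw [digitalShift, digitalNet_eq_ofDigits, (isProper_netDigits C hb n j).digits_ofDigits]

include hσ

lemma digitalShift_mem_Ico :
    digitalShift b (digitalNet b α m C n) σ j ∈ Set.Ico (0 : ℝ) 1 := by
  rw [digitalShift_digitalNet C hb]
  exact (isProper_netDigits_add C n j (isProper_digits hb (hσ j))).ofDigits_mem_Ico

lemma realDigit_digitalShift (i : ℕ) :
    realDigit b (digitalShift b (digitalNet b α m C n) σ j) i
      = ((netDigits C n j i : ℕ) : ZMod b) + realDigit b (σ j) i := by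
  rw [digitalShift_digitalNet C hb,
    (isProper_netDigits_add C n j (isProper_digits hb (hσ j))).realDigit_ofDigits, Fin.val_add,
    ZMod.natCast_mod, Nat.cast_add, natCast_digits (hσ j).1]

end Shift

lemma sum_natDigit_mul_netDigits (hb : 2 ≤ b) (n : ℕ) (j : Fin s) (k : ℕ) :
    ∑ i ∈ Finset.range k, (natDigit b k i : ZMod b) * ((netDigits C n j i : ℕ) : ZMod b)
      = digitVec b (α * m) k ⬝ᵥ (C j *ᵥ digitVec b m n) := by
  have hk : k < b ^ max k (α * m) := (Nat.lt_pow_self (by omega : 1 < b)).trans_le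
    (Nat.pow_le_pow_right (by omega) (le_max_left _ _))
  rw [sum_range_natDigit_mul hb hk fun i => ((netDigits C n j i : ℕ) : ZMod b),
    ← Finset.sum_subset (Finset.range_mono (le_max_right k (α * m))), Finset.sum_range, dotProduct]
  · refine Finset.sum_congr rfl fun i _ => ?_
    rw [natCast_netDigits, dif_pos i.isLt, digitVec]
  · intro i _ hi
    rw [natCast_netDigits, dif_neg (by simpa using hi), mul_zero]

lemma walsh_digitalShift (hb : 2 ≤ b) {σ : Fin s → ℝ} (hσ : ∀ j, σ j ∈ Set.Ico (0 : ℝ) 1)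
    (k n : ℕ) (j : Fin s) :
    walsh b k (digitalShift b (digitalNet b α m C n) σ j)
      = walsh b k (σ j)
        * stdAddChar (digitVec b (α * m) k ⬝ᵥ (C j *ᵥ digitVec b m n)) := by
  simp only [walsh, realDigit_digitalShift C hb hσ, mul_add, Finset.sum_add_distrib,
    AddChar.map_add_eq_mul, sum_natDigit_mul_netDigits C hb]
  ring

lemma tensor_walsh_digitalShift (hb : 2 ≤ b) {σ : Fin s → ℝ}
    (hσ : ∀ j, σ j ∈ Set.Ico (0 : ℝ) 1) (k : Fin s → ℕ) (n : ℕ) :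
    tensor (walsh b ∘ k) (digitalShift b (digitalNet b α m C n) σ)
      = tensor (walsh b ∘ k) σ * stdAddChar (dualVec C k ⬝ᵥ digitVec b m n) := by
  have hdual : dualVec C k ⬝ᵥ digitVec b m n
      = ∑ j, digitVec b (α * m) (k j) ⬝ᵥ (C j *ᵥ digitVec b m n) := by
    rw [dualVec, sum_dotProduct]
    refine Finset.sum_congr rfl fun j _ => ?_
    rw [Matrix.mulVec_transpose, Matrix.dotProduct_mulVec]
  have hsum : stdAddChar (∑ j, digitVec b (α * m) (k j) ⬝ᵥ (C j *ᵥ digitVec b m n))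
      = ∏ j, stdAddChar (digitVec b (α * m) (k j) ⬝ᵥ (C j *ᵥ digitVec b m n)) :=
    map_prod (stdAddChar (N := b)).toMonoidHom (fun _ => Multiplicative.ofAdd _) Finset.univ
  rw [hdual, hsum, tensor, tensor, ← Finset.prod_mul_distrib]
  exact Finset.prod_congr rfl fun j _ => walsh_digitalShift C hb hσ (k j) n j

lemma digitVec_bijective (b m : ℕ) [NeZero b] :
    Function.Bijective fun n : Fin (b ^ m) => digitVec b m n := by
  refine (Fintype.bijective_iff_injective_and_card _).mpr ⟨fun n n' h => ?_, by simp [ZMod.card]⟩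
  refine finFunctionFinEquiv.symm.injective (funext fun i => Fin.ext ?_)
  have hi : (natDigit b n i : ZMod b) = natDigit b n' i := congrFun h i
  rwa [ZMod.natCast_eq_natCast_iff', natDigit, natDigit, Nat.mod_mod, Nat.mod_mod] at hi

lemma sum_stdAddChar_dotProduct_digitVec {w : Fin m → ZMod b} (hw : w ≠ 0) :
    ∑ n ∈ Finset.range (b ^ m), stdAddChar (w ⬝ᵥ digitVec b m n) = 0 := by
  rw [Finset.sum_range, (digitVec_bijective b m).sum_comp fun v => stdAddChar (w ⬝ᵥ v)]
  let ψ : AddChar (Fin m → ZMod b) ℂ :=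
    stdAddChar.compAddMonoidHom (AddMonoidHom.mk' (w ⬝ᵥ ·) (dotProduct_add w))
  refine AddChar.sum_eq_zero_of_ne_one (ψ := ψ) fun hψ => hw (funext fun i => ?_)
  have hi : stdAddChar (w ⬝ᵥ Pi.single i 1) = 1 := DFunLike.congr_fun hψ (Pi.single i 1)
  rw [dotProduct_single_one, ← AddChar.map_zero_eq_one (stdAddChar (N := b))] at hi
  exact ZMod.injective_stdAddChar hi

end Net

/-! ### Quadrature errors of Walsh series -/

section Quadrature
variable {b : ℕ} [NeZero b] {s : ℕ}

/-- The equal-weight quadrature of the complex conjugate of the `k`-th Walsh function. -/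
def walshMean (b : ℕ) [NeZero b] (N : ℕ) (P : ℕ → Fin s → ℝ) (k : Fin s → ℕ) : ℂ :=
  1 / N * ∑ n ∈ Finset.range N, (starRingEnd ℂ) (tensor (walsh b ∘ k) (P n))

lemma enorm_walshMean_le_one (N : ℕ) (P : ℕ → Fin s → ℝ) (k : Fin s → ℕ) :
    ‖walshMean b N P k‖ₑ ≤ 1 := by
  have htensor (n : ℕ) : ‖(starRingEnd ℂ) (tensor (walsh b ∘ k) (P n))‖ ≤ 1 := by simp [tensor]
  have hsum := norm_sum_le_of_le (Finset.range N) fun n _ => htensor n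
  rw [← ofReal_norm, ← ENNReal.ofReal_one, walshMean, norm_mul, norm_div, norm_one,
    Complex.norm_natCast, one_div_mul_eq_div]
  exact ENNReal.ofReal_le_ofReal (div_le_one_of_le₀ (by simpa using hsum) (Nat.cast_nonneg N))

lemma pairing_walsh_zero (F : (Fin s → ℝ) → ℝ) :
    pairing F (walsh b ∘ 0) = ∫ x in cube s, (F x : ℂ) := by
  simp [pairing, tensor]

lemma walshMean_zero {N : ℕ} (hN : N ≠ 0) (P : ℕ → Fin s → ℝ) : walshMean b N P 0 = 1 := by
  simp [walshMean, tensor, hN]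

lemma mean_walshPartialSum_sub_integral {N : ℕ} (hN : N ≠ 0) (P : ℕ → Fin s → ℝ)
    (F : (Fin s → ℝ) → ℝ) (l : ℕ) :
    1 / N * ∑ n ∈ Finset.range N, walshPartialSum b l F (P n) - ∫ x in cube s, (F x : ℂ)
      = ∑ k ∈ (Fintype.piFinset fun _ => Finset.range (b ^ l)).erase 0,
        pairing F (walsh b ∘ k) * walshMean b N P k := by
  have h0 : (0 : Fin s → ℕ) ∈ Fintype.piFinset fun _ => Finset.range (b ^ l) := by
    simp [pow_pos (NeZero.pos b) l]
  rw [Finset.sum_erase_eq_sub h0, pairing_walsh_zero, walshMean_zero hN, mul_one]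
  congr 1
  simp only [walshPartialSum, walshMean]
  rw [Finset.sum_comm, Finset.mul_sum]
  refine Finset.sum_congr rfl fun k _ => ?_
  rw [← Finset.mul_sum]
  ring

lemma ofReal_quadratureError_eq_enorm (N : ℕ) (P : ℕ → Fin s → ℝ) (F : (Fin s → ℝ) → ℝ) :
    ENNReal.ofReal (quadratureError N P F)
      = ‖1 / N * ∑ n ∈ Finset.range N, (F (P n) : ℂ) - ∫ x in cube s, (F x : ℂ)‖ₑ := by
  have hint : ∫ x in cube s, (F x : ℂ) = ((∫ x in cube s, F x : ℝ) : ℂ) := integral_ofReal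
  rw [quadratureError, ← ofReal_norm, hint, ← Real.norm_eq_abs, ← Complex.norm_real]
  push_cast
  rfl

lemma ofReal_quadratureError_le_tsum (hb : 2 ≤ b) {N : ℕ} (hN : N ≠ 0) {P : ℕ → Fin s → ℝ}
    (hP : ∀ n j, P n j ∈ Set.Ico (0 : ℝ) 1) {F : (Fin s → ℝ) → ℝ} (hF : ContinuousOn F (cube s)) :
    ENNReal.ofReal (quadratureError N P F)
      ≤ ∑' k : {k : Fin s → ℕ | k ≠ 0}, ‖pairing F (walsh b ∘ k)‖ₑ * ‖walshMean b N P k‖ₑ := by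
  have hlim : Filter.Tendsto (fun l => 1 / N * ∑ n ∈ Finset.range N,
      walshPartialSum b l F (P n) - ∫ x in cube s, (F x : ℂ)) Filter.atTop
      (nhds (1 / N * ∑ n ∈ Finset.range N, (F (P n) : ℂ) - ∫ x in cube s, (F x : ℂ))) :=
    ((tendsto_finsetSum _ fun n _ => tendsto_walshPartialSum hb hF (hP n)).const_mul _).sub_const _
  rw [ofReal_quadratureError_eq_enorm]
  refine le_of_tendsto hlim.enorm (.of_forall fun l => ?_)
  rw [mean_walshPartialSum_sub_integral hN]
  refine (enorm_sum_le _ _).trans ?_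
  simp only [enorm_mul]
  set S := (Fintype.piFinset fun _ : Fin s => Finset.range (b ^ l)).erase 0
  let f (k : Fin s → ℕ) : ℝ≥0∞ := ‖pairing F (walsh b ∘ k)‖ₑ * ‖walshMean b N P k‖ₑ
  calc ∑ k ∈ S, f k = ∑' k : S, f k := (Finset.tsum_subtype S f).symm
    _ ≤ ∑' k : {k : Fin s → ℕ | k ≠ 0}, f k :=
      ENNReal.tsum_mono_subtype f fun k hk => Finset.ne_of_mem_erase hk

variable {α m : ℕ} (C : Fin s → Matrix (Fin (α * m)) (Fin m) (ZMod b))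

lemma walshMean_digitalNet_eq_zero (hb : 2 ≤ b) {σ : Fin s → ℝ}
    (hσ : ∀ j, σ j ∈ Set.Ico (0 : ℝ) 1) {k : Fin s → ℕ} (hk : dualVec C k ≠ 0) :
    walshMean b (b ^ m) (fun n => digitalShift b (digitalNet b α m C n) σ) k = 0 := by
  simp only [walshMean, ← map_sum, tensor_walsh_digitalShift C hb hσ, ← Finset.mul_sum,
    sum_stdAddChar_dotProduct_digitVec hk, mul_zero, map_zero]

lemma ofReal_quadratureError_digitalNet_le (hb : 2 ≤ b) {σ : Fin s → ℝ}
    (hσ : ∀ j, σ j ∈ Set.Ico (0 : ℝ) 1) {F : (Fin s → ℝ) → ℝ} (hF : ContinuousOn F (cube s)) :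
    ENNReal.ofReal
        (quadratureError (b ^ m) (fun n => digitalShift b (digitalNet b α m C n) σ) F)
      ≤ ∑' k : {k : Fin s → ℕ | k ≠ 0 ∧ dualVec C k = 0}, ‖pairing F (walsh b ∘ k)‖ₑ := by
  set P := fun n => digitalShift b (digitalNet b α m C n) σ with hP
  let f (k : Fin s → ℕ) : ℝ≥0∞ := ‖pairing F (walsh b ∘ k)‖ₑ * ‖walshMean b (b ^ m) P k‖ₑ
  have hf (k : Fin s → ℕ) (hk : dualVec C k ≠ 0) : f k = 0 := by
    simp [f, hP, walshMean_digitalNet_eq_zero C hb hσ hk]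
  calc ENNReal.ofReal (quadratureError (b ^ m) P F)
      ≤ ∑' k : {k : Fin s → ℕ | k ≠ 0}, f k :=
        ofReal_quadratureError_le_tsum hb (pow_ne_zero m (NeZero.ne b))
          (fun n j => digitalShift_mem_Ico C hb hσ n j) hF
    _ = ∑' k : {k : Fin s → ℕ | k ≠ 0 ∧ dualVec C k = 0}, f k := by
        rw [tsum_subtype, tsum_subtype]
        refine tsum_congr fun k => ?_
        by_cases hk : dualVec C k = 0 <;> simp [Set.indicator_apply, hk, hf]
    _ ≤ ∑' k : {k : Fin s → ℕ | k ≠ 0 ∧ dualVec C k = 0}, ‖pairing F (walsh b ∘ k)‖ₑ :=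
        ENNReal.tsum_le_tsum fun k => mul_le_of_le_one_right' (enorm_walshMean_le_one _ _ _)

end Quadrature

/-! ### Finiteness of the error criterion -/

section Finiteness
variable {b : ℕ} (hb : 2 ≤ b)

/-- The sum of `b ^ (-μ_α(k))` over the `k` with at most `l` digits. -/
def muSum (α b l : ℕ) : ℝ := ∑ k ∈ Finset.range (b ^ l), (b : ℝ)⁻¹ ^ mu α b k

lemma muSum_nonneg (α l : ℕ) : 0 ≤ muSum α b l := Finset.sum_nonneg fun _ _ => by positivity

include hb

lemma muSum_succ (α l : ℕ) :
    muSum (α + 1) b (l + 1)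
      = ((b : ℝ) - 1) * (b : ℝ)⁻¹ ^ (l + 1) * muSum α b l + muSum (α + 1) b l := by
  have hleading (κ : ℕ) (hκ : κ ∈ Finset.range (b - 1)) :
      ∑ K ∈ Finset.range (b ^ l), (b : ℝ)⁻¹ ^ mu (α + 1) b ((κ + 1) * b ^ l + K)
        = (b : ℝ)⁻¹ ^ (l + 1) * muSum α b l := by
    rw [muSum, Finset.mul_sum]
    refine Finset.sum_congr rfl fun K hK => ?_
    have hκ' : κ + 1 < b := by have := Finset.mem_range.mp hκ; omega
    rw [mu_leading_add hb κ.succ_pos hκ' (Finset.mem_range.mp hK), pow_add]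
  have hsplit : Finset.range b = Finset.range (b - 1 + 1) := by rw [Nat.sub_add_cancel (by omega)]
  rw [muSum, sum_range_pow_succ, hsplit, Finset.sum_range_succ', Finset.sum_congr rfl hleading,
    Finset.sum_const, Finset.card_range, nsmul_eq_mul, Nat.cast_sub (by omega), Nat.cast_one,
    ← mul_assoc]
  simp [muSum]

lemma inv_natCast_le_half : (b : ℝ)⁻¹ ≤ 1 / 2 := by
  rw [one_div]
  exact inv_anti₀ two_pos (by exact_mod_cast hb)

lemma sub_one_mul_inv_pow_le (l : ℕ) : ((b : ℝ) - 1) * (b : ℝ)⁻¹ ^ (l + 1) ≤ (b : ℝ)⁻¹ ^ l := by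
  have hb0 : (b : ℝ) ≠ 0 := by exact_mod_cast (by omega : b ≠ 0)
  have hpow : (b : ℝ)⁻¹ ^ l = b * (b : ℝ)⁻¹ ^ (l + 1) := by rw [pow_succ']; field_simp
  rw [hpow]
  gcongr
  linarith

lemma muSum_le_pow (α l : ℕ) : muSum α b l ≤ (b : ℝ) ^ l := by
  refine (Finset.sum_le_card_nsmul _ _ 1 fun k _ => ?_).trans (by simp)
  exact pow_le_one₀ (by positivity) ((inv_natCast_le_half hb).trans (by norm_num))

lemma muSum_le_linear (α l : ℕ) : muSum (α + 1) b l ≤ 1 + l := by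
  induction l with
  | zero => simp [muSum]
  | succ l ih =>
    have hstep : ((b : ℝ) - 1) * (b : ℝ)⁻¹ ^ (l + 1) * muSum α b l ≤ 1 :=
      calc _ ≤ (b : ℝ)⁻¹ ^ l * (b : ℝ) ^ l :=
            mul_le_mul (sub_one_mul_inv_pow_le hb l) (muSum_le_pow hb α l) (muSum_nonneg α l)
              (by positivity)
        _ = 1 := by rw [inv_pow, inv_mul_cancel₀ (pow_ne_zero l (by positivity))]
    rw [muSum_succ hb]
    push_cast
    linarith

lemma muSum_le_sub (α l : ℕ) :
    muSum (α + 2) b l ≤ 5 - ((l : ℝ) + 2) * 2 * (1 / 2) ^ l := by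
  induction l with
  | zero => norm_num [muSum]
  | succ l ih =>
    have hstep : ((b : ℝ) - 1) * (b : ℝ)⁻¹ ^ (l + 1) * muSum (α + 1) b l
        ≤ (1 / 2) ^ l * (1 + l) :=
      mul_le_mul ((sub_one_mul_inv_pow_le hb l).trans
          (pow_le_pow_left₀ (by positivity) (inv_natCast_le_half hb) l))
        (muSum_le_linear hb α l) (muSum_nonneg _ l) (by positivity)
    rw [muSum_succ hb, pow_succ (1 / 2 : ℝ)]
    push_cast
    linarith

lemma muSum_le_five {α : ℕ} (hα : 2 ≤ α) (l : ℕ) : muSum α b l ≤ 5 := by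
  obtain ⟨β, rfl⟩ := Nat.exists_eq_add_of_le' hα
  have : (0 : ℝ) ≤ ((l : ℝ) + 2) * 2 * (1 / 2) ^ l := by positivity
  exact (muSum_le_sub hb β l).trans (by linarith)

lemma sum_inv_pow_mu_le {α : ℕ} (hα : 2 ≤ α) {ι : Type*} [Fintype ι] (A : Finset (ι → ℕ)) :
    ∑ k ∈ A, (b : ℝ)⁻¹ ^ ∑ j, mu α b (k j) ≤ 5 ^ Fintype.card ι := by
  classical
  set l := A.sup fun k => ∑ j, k j
  have hA : A ⊆ Fintype.piFinset fun _ => Finset.range (b ^ l) := fun k hk => by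
    refine Fintype.mem_piFinset.mpr fun j => Finset.mem_range.mpr ?_
    calc k j ≤ ∑ j, k j := Finset.single_le_sum (fun _ _ => Nat.zero_le _) (Finset.mem_univ j)
      _ ≤ l := Finset.le_sup (f := fun k : ι → ℕ => ∑ j, k j) hk
      _ < b ^ l := Nat.lt_pow_self (by omega)
  calc ∑ k ∈ A, (b : ℝ)⁻¹ ^ ∑ j, mu α b (k j)
      ≤ ∑ k ∈ Fintype.piFinset fun _ : ι => Finset.range (b ^ l),
          (b : ℝ)⁻¹ ^ ∑ j, mu α b (k j) :=
        Finset.sum_le_sum_of_subset_of_nonneg hA fun _ _ _ => by positivity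
    _ = muSum α b l ^ Fintype.card ι := by
        simp only [← Finset.prod_pow_eq_pow_sum]
        rw [← Finset.prod_univ_sum (fun _ => Finset.range (b ^ l))
          (fun _ i => (b : ℝ)⁻¹ ^ mu α b i), Finset.prod_const, Finset.card_univ, muSum]
    _ ≤ 5 ^ Fintype.card ι :=
        pow_le_pow_left₀ (muSum_nonneg α l) (muSum_le_five hb hα l) _

lemma tsum_inv_pow_mu_lt_top {α : ℕ} (hα : 2 ≤ α) {ι : Type*} [Fintype ι] (S : Set (ι → ℕ)) :
    ∑' k : S, (b : ℝ≥0∞)⁻¹ ^ ∑ j, mu α b ((k : ι → ℕ) j) < ⊤ := by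
  have hofReal (k : ι → ℕ) : (b : ℝ≥0∞)⁻¹ ^ ∑ j, mu α b (k j)
      = ENNReal.ofReal ((b : ℝ)⁻¹ ^ ∑ j, mu α b (k j)) := by
    rw [ENNReal.ofReal_pow (by positivity), ENNReal.ofReal_inv_of_pos (by positivity),
      ENNReal.ofReal_natCast]
  calc ∑' k : S, (b : ℝ≥0∞)⁻¹ ^ ∑ j, mu α b ((k : ι → ℕ) j)
      ≤ ∑' k : ι → ℕ, (b : ℝ≥0∞)⁻¹ ^ ∑ j, mu α b (k j) :=
        ENNReal.tsum_comp_le_tsum_of_injective Subtype.val_injective _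
    _ ≤ ENNReal.ofReal (5 ^ Fintype.card ι) := by
        rw [ENNReal.tsum_eq_iSup_sum]
        refine iSup_le fun A => ?_
        simp only [hofReal]
        rw [← ENNReal.ofReal_sum_of_nonneg fun _ _ => by positivity]
        exact ENNReal.ofReal_le_ofReal (sum_inv_pow_mu_le hb hα A)
    _ < ⊤ := ENNReal.ofReal_lt_top

end Finiteness

/-! ### Hölder's inequality for `lpSum` -/

section LpSum
variable {ι : Type*}

lemma lpSum_lt_top {p : ℝ≥0∞} {S : Finset ι} {a : ι → ℝ≥0∞} (h : ∀ i ∈ S, a i < ⊤) :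
    lpSum p S a < ⊤ := by
  unfold lpSum
  split_ifs
  · exact (Finset.sup_lt_iff ENNReal.zero_lt_top).mpr h
  · refine ENNReal.rpow_lt_top_of_nonneg (by positivity) (ENNReal.sum_lt_top.mpr fun i hi => ?_).ne
    exact ENNReal.rpow_lt_top_of_nonneg (by positivity) (h i hi).ne

lemma le_lpSum {p : ℝ≥0∞} (hp : p ≠ 0) {S : Finset ι} (a : ι → ℝ≥0∞) {i : ι} (hi : i ∈ S) :
    a i ≤ lpSum p S a := by
  unfold lpSum
  split_ifs with h
  · exact Finset.le_sup hi
  · rw [one_div, ENNReal.le_rpow_inv_iff (ENNReal.toReal_pos hp h)]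
    exact Finset.single_le_sum (f := fun i => a i ^ p.toReal) (fun _ _ => zero_le) hi

lemma lpSum_mono_set {p : ℝ≥0∞} {S T : Finset ι} (h : S ⊆ T) (a : ι → ℝ≥0∞) :
    lpSum p S a ≤ lpSum p T a := by
  unfold lpSum
  split_ifs
  · exact Finset.sup_mono h
  · gcongr

lemma sum_mul_le_lpSum_one_mul_lpSum_top (S : Finset ι) (a c : ι → ℝ≥0∞) :
    ∑ i ∈ S, a i * c i ≤ lpSum 1 S a * lpSum ⊤ S c := by
  have hone : lpSum 1 S a = ∑ i ∈ S, a i := by simp [lpSum]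
  rw [hone, Finset.sum_mul]
  gcongr with i hi
  exact le_lpSum ENNReal.top_ne_zero c hi

lemma sum_mul_le_lpSum_mul_lpSum {p q : ℝ≥0∞} (h : 1 / p + 1 / q = 1) (S : Finset ι)
    (a c : ι → ℝ≥0∞) : ∑ i ∈ S, a i * c i ≤ lpSum p S a * lpSum q S c := by
  rcases eq_or_ne q ⊤ with rfl | hq
  · obtain rfl : p = 1 := by simpa using h
    exact sum_mul_le_lpSum_one_mul_lpSum_top S a c
  rcases eq_or_ne p ⊤ with rfl | hp
  · obtain rfl : q = 1 := by simpa using h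
    simp only [mul_comm (a _)]
    rw [mul_comm]
    exact sum_mul_le_lpSum_one_mul_lpSum_top S c a
  have : ENNReal.HolderConjugate p q :=
    ENNReal.holderConjugate_iff.mpr (by simpa only [one_div] using h)
  have hconj : p.toReal.HolderConjugate q.toReal := ENNReal.HolderConjugate.toReal_of_ne_top hp hq
  rw [lpSum, lpSum, if_neg hp, if_neg hq]
  exact ENNReal.inner_le_Lp_mul_Lq S a c hconj

end LpSum

/-! ### The worst-case error -/

section WorstCase
variable {b s α m : ℕ} {q r r' : ℝ≥0∞} {γ : Finset (Fin s) → ℝ≥0} {F : (Fin s → ℝ) → ℝ}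
  {D : (Fin s → ℕ) → (Fin s → ℝ) → ℝ}

/-- The support of a multi-index. -/
def supp (k : Fin s → ℕ) : Finset (Fin s) := {j | k j ≠ 0}

lemma mem_supp {k : Fin s → ℕ} {j : Fin s} : j ∈ supp k ↔ k j ≠ 0 := by simp [supp]

lemma supp_nonempty {k : Fin s → ℕ} (hk : k ≠ 0) : (supp k).Nonempty :=
  have ⟨j, hj⟩ := Function.ne_iff.mp hk
  ⟨j, mem_supp.mpr hj⟩

/-- The contribution of `u` to the norm of the function space, before weighting: the `ℓ_q`
combination of the `L_q` norms of the derivative integrals that belong to `u`. -/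
def derivNorm (α : ℕ) (q : ℝ≥0∞) (D : (Fin s → ℕ) → (Fin s → ℝ) → ℝ) (u : Finset (Fin s)) :
    ℝ≥0∞ :=
  lpSum q (derivIndices α u) fun p =>
    eLpNorm (integrateOut p.1 (D (multiIndex α p.1 p.2))) q (volume.restrict (cube s))

/-- The contribution of `u` to the error criterion, before weighting. -/
def dualSum (b α m : ℕ) (C : Fin s → Matrix (Fin (α * m)) (Fin m) (ZMod b))
    (u : Finset (Fin s)) : ℝ≥0∞ :=
  ENNReal.ofReal (walshConst α b) ^ u.card *
    ∑' k : dualNet b α m C u, (b : ℝ≥0∞)⁻¹ ^ ∑ j : u, mu α b ((k : u → ℕ) j)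

lemma multiIndex_le {u : Finset (Fin s)} {p : Σ _ : Finset (Fin s), Fin s → ℕ}
    (hp : p ∈ derivIndices α u) (j : Fin s) : multiIndex α p.1 p.2 j ≤ α := by
  have hτ := Fintype.mem_piFinset.mp (Finset.mem_sigma.mp hp).2 j
  unfold multiIndex
  split_ifs at hτ ⊢
  · exact le_rfl
  · exact le_rfl
  · exact (Finset.mem_Icc.mp hτ).2
  · simp [Finset.mem_singleton.mp hτ]

lemma eLpNorm_one_integrateOut_le_derivNorm (hq : 1 ≤ q) (hD : IsMixedDerivFamily α F D)
    {u : Finset (Fin s)} {p : Σ _ : Finset (Fin s), Fin s → ℕ} (hp : p ∈ derivIndices α u) :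
    eLpNorm (integrateOut p.1 (D (multiIndex α p.1 p.2))) 1 (volume.restrict (cube s))
      ≤ derivNorm α q D u := by
  have hint := integrable_integrateOut (v := p.1) (hD.integrable _ (multiIndex_le hp))
  exact (eLpNorm_le_eLpNorm_of_exponent_le hq hint.aestronglyMeasurable).trans
    (le_lpSum (zero_lt_one.trans_le hq).ne' (fun p : Σ _ : Finset (Fin s), Fin s → ℕ =>
      eLpNorm (integrateOut p.1 (D (multiIndex α p.1 p.2))) q (volume.restrict (cube s))) hp)

lemma isPartsStage_walsh [NeZero b] (hb : 2 ≤ b) (α : ℕ) (k : Fin s → ℕ) :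
    IsPartsStage α (supp k) (supp k) 0 (walsh b ∘ k) where
  le _ := Nat.zero_le α
  eq_zero _ _ := rfl
  subset := subset_rfl
  eq_one j hj := by
    rw [mem_supp, not_not] at hj
    funext x
    rw [Function.comp_apply, hj, walsh_zero]
  mean_zero j hj _ := ⟨hj, prim_walsh_one hb (mem_supp.mp hj)⟩
  bddMeasurable j := bddMeasurable_walsh hb (k j)
  periodic j := periodic_walsh b (k j)

lemma enorm_pairing_walsh_le [NeZero b] (hb : 2 ≤ b) (hα : 2 ≤ α) (hq : 1 ≤ q)
    (hD : IsMixedDerivFamily α F D) (k : Fin s → ℕ) :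
    ‖pairing F (walsh b ∘ k)‖ₑ
      ≤ ENNReal.ofReal (walshConst α b) ^ (supp k).card
        * (b : ℝ≥0∞)⁻¹ ^ (∑ j ∈ supp k, mu α b (k j)) * derivNorm α q D (supp k) := by
  have hparts := (isPartsStage_walsh hb α k).enorm_pairing_le hD
    fun p hp => eLpNorm_one_integrateOut_le_derivNorm hq hD hp
  rw [hD.zero] at hparts
  refine hparts.trans (mul_le_mul_left ?_ _)
  calc ∏ j ∈ supp k, primNorm α (walsh b (k j))
      ≤ ∏ j ∈ supp k, ENNReal.ofReal (walshConst α b) * (b : ℝ≥0∞)⁻¹ ^ mu α b (k j) :=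
        Finset.prod_le_prod' fun j hj => primNorm_walsh_le hb hα (mem_supp.mp hj)
    _ = _ := by rw [Finset.prod_mul_distrib, Finset.prod_const, Finset.prod_pow_eq_pow_sum]

section DualNet
variable (C : Fin s → Matrix (Fin (α * m)) (Fin m) (ZMod b))

lemma restrict_mem_dualNet {k : Fin s → ℕ} (hk : dualVec C k = 0) :
    (fun j : supp k => k j) ∈ dualNet b α m C (supp k) := by
  refine ⟨fun j => Nat.one_le_iff_ne_zero.mpr (mem_supp.mp j.2), ?_⟩
  rw [← hk, dualVec, Finset.sum_coe_sort (supp k) fun j => (C j)ᵀ *ᵥ digitVec b (α * m) (k j)]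
  refine Finset.sum_subset (Finset.subset_univ _) fun j _ hj => ?_
  have hzero : digitVec b (α * m) 0 = 0 := by
    funext i
    simp [digitVec, natDigit]
  rw [mem_supp, not_not] at hj
  rw [hj, hzero, Matrix.mulVec_zero]

lemma tsum_supp_eq_le_dualSum (u : Finset (Fin s)) :
    ∑' k : {k : Fin s → ℕ | dualVec C k = 0 ∧ supp k = u},
        ENNReal.ofReal (walshConst α b) ^ u.card
          * (b : ℝ≥0∞)⁻¹ ^ ∑ j ∈ u, mu α b ((k : Fin s → ℕ) j)
      ≤ dualSum b α m C u := by
  let φ (k : {k : Fin s → ℕ | dualVec C k = 0 ∧ supp k = u}) : dualNet b α m C u :=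
    ⟨fun j => (k : Fin s → ℕ) j, by
      obtain ⟨k, hk, rfl⟩ := k
      exact restrict_mem_dualNet C hk⟩
  have hφ : Function.Injective φ := fun k k' h => by
    refine Subtype.ext (funext fun j => ?_)
    by_cases hj : j ∈ u
    · exact congrFun (congrArg Subtype.val h) ⟨j, hj⟩
    · have hk : j ∉ supp (k : Fin s → ℕ) := by rwa [k.2.2]
      have hk' : j ∉ supp (k' : Fin s → ℕ) := by rwa [k'.2.2]
      rw [mem_supp, not_not] at hk hk'
      rw [hk, hk']
  rw [ENNReal.tsum_mul_left, dualSum]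
  gcongr
  refine le_of_eq_of_le (tsum_congr fun k => ?_) (ENNReal.tsum_comp_le_tsum_of_injective hφ
    fun k : dualNet b α m C u => (b : ℝ≥0∞)⁻¹ ^ ∑ j : u, mu α b ((k : u → ℕ) j))
  rw [Finset.sum_coe_sort u fun j => mu α b ((k : Fin s → ℕ) j)]

lemma ofReal_quadratureError_le_sum_dualSum [NeZero b] (hb : 2 ≤ b) (hα : 2 ≤ α) (hq : 1 ≤ q)
    {σ : Fin s → ℝ} (hσ : ∀ j, σ j ∈ Set.Ico (0 : ℝ) 1) (hF : ContinuousOn F (cube s))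
    (hD : IsMixedDerivFamily α F D) :
    ENNReal.ofReal
        (quadratureError (b ^ m) (fun n => digitalShift b (digitalNet b α m C n) σ) F)
      ≤ ∑ u : Finset (Fin s) with u.Nonempty, dualSum b α m C u * derivNorm α q D u := by
  let f (k : Fin s → ℕ) : ℝ≥0∞ := ‖pairing F (walsh b ∘ k)‖ₑ
  have hcover : {k : Fin s → ℕ | k ≠ 0 ∧ dualVec C k = 0}
      ⊆ ⋃ u ∈ ({u | u.Nonempty} : Finset (Finset (Fin s))),
        {k : Fin s → ℕ | dualVec C k = 0 ∧ supp k = u} := fun k hk =>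
    Set.mem_iUnion₂.mpr ⟨supp k, by simpa using supp_nonempty hk.1, hk.2, rfl⟩
  refine (ofReal_quadratureError_digitalNet_le C hb hσ hF).trans <|
    (ENNReal.tsum_mono_subtype f hcover).trans <| (ENNReal.tsum_biUnion_le f _ _).trans ?_
  refine Finset.sum_le_sum fun u _ => ?_
  refine le_trans ?_ (mul_le_mul_left (tsum_supp_eq_le_dualSum C u) (derivNorm α q D u))
  rw [← ENNReal.tsum_mul_right]
  refine ENNReal.tsum_le_tsum fun ⟨k, _, hk⟩ => ?_
  subst hk
  exact enorm_pairing_walsh_le hb hα hq hD k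

end DualNet

variable (C : Fin s → Matrix (Fin (α * m)) (Fin m) (ZMod b))

lemma errorCriterion_eq : errorCriterion b α m γ r' C
    = lpSum r' {u : Finset (Fin s) | u.Nonempty} fun u => γ u * dualSum b α m C u := by
  unfold errorCriterion dualSum
  congr 1 with u
  ring

theorem errorCriterion_lt_top (hb : 2 ≤ b) (hα : 2 ≤ α) : errorCriterion b α m γ r' C < ⊤ := by
  rw [errorCriterion_eq]
  exact lpSum_lt_top fun u _ => ENNReal.mul_lt_top ENNReal.coe_lt_top <|
    ENNReal.mul_lt_top (ENNReal.pow_lt_top ENNReal.ofReal_lt_top) (tsum_inv_pow_mu_lt_top hb hα _)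

lemma le_mul_inv_mul {c : ℝ≥0} {d : ℝ≥0∞} (h : (c : ℝ≥0∞)⁻¹ * d ≠ ⊤) :
    d ≤ c * ((c : ℝ≥0∞)⁻¹ * d) := by
  rcases eq_or_ne c 0 with rfl | hc
  · have hd : d = 0 := by
      by_contra hd
      exact h (by simp [ENNReal.top_mul hd])
    simp [hd]
  · rw [ENNReal.mul_inv_cancel_left (by exact_mod_cast hc) ENNReal.coe_ne_top]

lemma sum_dualSum_mul_derivNorm_le (hrr' : 1 / r + 1 / r' = 1)
    (hfin : familyNorm α γ q r D ≠ ⊤) :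
    ∑ u : Finset (Fin s) with u.Nonempty, dualSum b α m C u * derivNorm α q D u
      ≤ errorCriterion b α m γ r' C * familyNorm α γ q r D := by
  have hr : r ≠ 0 := by
    rintro rfl
    simp at hrr'
  have hweighted (u : Finset (Fin s)) : (γ u : ℝ≥0∞)⁻¹ * derivNorm α q D u ≠ ⊤ :=
    ne_top_of_le_ne_top hfin
      (le_lpSum hr (fun u => (γ u : ℝ≥0∞)⁻¹ * derivNorm α q D u) (Finset.mem_univ u))
  calc ∑ u : Finset (Fin s) with u.Nonempty, dualSum b α m C u * derivNorm α q D u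
      ≤ ∑ u : Finset (Fin s) with u.Nonempty,
          (γ u * dualSum b α m C u) * ((γ u : ℝ≥0∞)⁻¹ * derivNorm α q D u) := by
        refine Finset.sum_le_sum fun u _ => ?_
        rw [mul_comm (γ u : ℝ≥0∞), mul_assoc]
        gcongr
        exact le_mul_inv_mul (hweighted u)
    _ ≤ lpSum r' {u : Finset (Fin s) | u.Nonempty} (fun u => γ u * dualSum b α m C u)
          * lpSum r {u : Finset (Fin s) | u.Nonempty}
            (fun u => (γ u : ℝ≥0∞)⁻¹ * derivNorm α q D u) :=
        sum_mul_le_lpSum_mul_lpSum (by rwa [add_comm]) _ _ _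
    _ ≤ errorCriterion b α m γ r' C * familyNorm α γ q r D := by
        rw [errorCriterion_eq]
        gcongr
        exact lpSum_mono_set (Finset.subset_univ _) _

variable [NeZero b] (hb : 2 ≤ b) (hα : 2 ≤ α) (hq : 1 ≤ q) (hrr' : 1 / r + 1 / r' = 1)
  {σ : Fin s → ℝ} (hσ : ∀ j, σ j ∈ Set.Ico (0 : ℝ) 1)
include hb hα hq hrr' hσ

theorem ofReal_quadratureError_le_mul_sobolevNorm (hF : F ∈ sobolevSpace α γ q r) :
    ENNReal.ofReal
        (quadratureError (b ^ m) (fun n => digitalShift b (digitalNet b α m C n) σ) F)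
      ≤ errorCriterion b α m γ r' C * sobolevNorm α γ q r F := by
  refine ENNReal.le_mul_of_forall_lt (.inr hF.2.ne) (.inl (errorCriterion_lt_top C hb hα).ne)
    fun e he c hc => ?_
  simp only [sobolevNorm, gt_iff_lt, iInf_lt_iff] at hc
  obtain ⟨D, hD, hDc⟩ := hc
  calc _ ≤ ∑ u : Finset (Fin s) with u.Nonempty, dualSum b α m C u * derivNorm α q D u :=
        ofReal_quadratureError_le_sum_dualSum C hb hα hq hσ hF.1 hD
    _ ≤ errorCriterion b α m γ r' C * familyNorm α γ q r D :=
        sum_dualSum_mul_derivNorm_le C hrr' hDc.ne_top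
    _ ≤ e * c := mul_le_mul' he.le hDc.le

theorem worstCaseError_digitalShift_le :
    worstCaseError α γ q r (b ^ m) (fun n => digitalShift b (digitalNet b α m C n) σ)
      ≤ errorCriterion b α m γ r' C := by
  refine iSup₂_le fun F hF => ?_
  exact (ofReal_quadratureError_le_mul_sobolevNorm C hb hα hq hrr' hσ hF.1).trans
    (mul_le_of_le_one_right' hF.2)

end WorstCase

end QMC

end

theorem mainTheorem3_general (s α b m : ℕ) [NeZero b] (hb : 2 ≤ b) (hα : 1 < α)
    (q r r' : ℝ≥0∞) (hq : 1 ≤ q) (hrr' : 1 / r + 1 / r' = 1) (γ : Finset (Fin s) → ℝ≥0)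
    (C : Fin s → Matrix (Fin (α * m)) (Fin m) (ZMod b)) :
    QMC.errorCriterion b α m γ r' C < ⊤ ∧
    QMC.worstCaseError α γ q r (b ^ m) (QMC.digitalNet b α m C)
      ≤ QMC.errorCriterion b α m γ r' C ∧
    ∀ σ : Fin s → ℝ, (∀ j, σ j ∈ Set.Ico (0 : ℝ) 1) →
      QMC.worstCaseError α γ q r (b ^ m)
          (fun n => QMC.digitalShift b (QMC.digitalNet b α m C n) σ)
        ≤ QMC.errorCriterion b α m γ r' C := by
  have hshift (σ : Fin s → ℝ) (hσ : ∀ j, σ j ∈ Set.Ico (0 : ℝ) 1) :=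
    QMC.worstCaseError_digitalShift_le (γ := γ) C hb hα hq hrr' hσ
  refine ⟨QMC.errorCriterion_lt_top C hb hα, ?_, hshift⟩
  simpa only [QMC.digitalShift_zero C hb] using hshift 0 fun _ => ⟨le_rfl, zero_lt_one⟩

theorem mainTheorem3 (s α b m : ℕ) [Fact b.Prime] (hs : 1 ≤ s) (hα : 1 < α) (hm : 1 ≤ m)
    (q r r' : ℝ≥0∞) (hq : 1 ≤ q) (hr : 1 ≤ r) (hr' : 1 ≤ r') (hrr' : 1 / r + 1 / r' = 1)
    (γ : Finset (Fin s) → ℝ≥0)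
    (C : Fin s → Matrix (Fin (α * m)) (Fin m) (ZMod b)) :
    QMC.errorCriterion b α m γ r' C < ⊤ ∧
    QMC.worstCaseError α γ q r (b ^ m) (QMC.digitalNet b α m C)
      ≤ QMC.errorCriterion b α m γ r' C ∧
    ∀ σ : Fin s → ℝ, (∀ j, σ j ∈ Set.Ico (0 : ℝ) 1) →
      QMC.worstCaseError α γ q r (b ^ m)
          (fun n => QMC.digitalShift b (QMC.digitalNet b α m C n) σ)
        ≤ QMC.errorCriterion b α m γ r' C :=
  mainTheorem3_general s α b m (Fact.out : b.Prime).two_le hα q r r' hq hrr' γ C
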